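/- Let $N\ge 2$, let $p_1,\dots,p_{N+1}\in\mathbb R^N$ be affinely independent, $S=\{1,\dots,N+1\}$, $V_0=\{p_i\}_{i\in S}$, and $\tilde K$ the convex hull of $V_0$. Put $\psi_i(z)=(z+p_i)/2$, $\psi_w=\psi_{w_1}\circ\cdots\circ\psi_{w_m}$ for a word $w=w_1\cdots w_m\in W_m=S^m$ ($\psi_\emptyset=\mathrm{id}$), $W_*=\bigcup_{m\ge0} W_m$, and let $$K=\bigcap_{m\ge0}\bigcup_{w\in W_m}\psi_w(\tilde K),\qquad K_w=\psi_w(K),\qquad V_m=\bigcup_{w\in W_m}\psi_w(V_0),\qquad V_*=\bigcup_{m\ge0}V_m .$$ So $K$ is the $N$-dimensional Sierpinski gasket. For $f:V_*\to\mathbb R$ let $$\mathcal E_*(f,f)=\lim_{m\to\infty}\Big(\frac{N+3}{N+1}\Big)^m\sum_{w\in W_m}\frac12\sum_{i,j\in S}\big(f(\psi_w(p_i))-f(\psi_w(p_j))\big)^2\in[0,\infty]$$ (the limit of a nondecreasing sequence), let $\mathcal F=\{f\in C(K):\mathcal E_*(f|_{V_*},f|_{V_*})<\infty\}$, and let $\mathcal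 E$ be the symmetric bilinear form on $\mathcal F$ obtained from $f\mapsto\mathcal E_*(f|_{V_*},f|_{V_*})$ by polarization. The energy measure $\nu_f$ of $f\in\mathcal F$ is the unique finite Borel measure on $K$ with $\int_K g\,d\nu_f=2\mathcal E(f,fg)-\mathcal E(f^2,g)$ for all $g\in\mathcal F$. A function $h\in\mathcal F$ is harmonic if $\mathcal E(h,h)\le\mathcal E(f,f)$ for all $f\in\mathcal F$ with $f|_{V_0}=h|_{V_0}$. For $k\in S$ let $h_k$ be the unique harmonic function with $h_k(p_k)=1$ and $h_k(p_i)=0$ for $i\ne k$, and let $\nu=\sum_{k\in S}\nu_{h_k}$ be the Kusuoka measure. Let $h$ be harmonic. Then $0<\nu(K_w)<\infty$ for every $w\in W_*$, and for all $w\in W_*$ and $i,j\in S$ the following two limits exist in $\mathbb R$ and coincide: $$\lim_{n\to\infty}\frac{\nu_h(K_{wij^n})}{\nu(K_{wij^n})}=\lim_{n\to\infty}\frac{\nu_h(K_{wji^n})}{\nu(K_{wji^n})},$$ where $j^n$ denotes the word $j\cdots j$ of length $n$. Consequently the function $\delta\nu_h/\delta\nu$ is well defined on $V_*$: there is exactly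 one function $\frac{\delta\nu_h}{\delta\nu}:V_*\to\mathbb R$ such that $$\frac{\delta\nu_h}{\delta\nu}(x)=\lim_{n\to\infty}\frac{\nu_h(K_{wij^n})}{\nu(K_{wij^n})}\qquad\text{whenever } x=\psi_{wi}(p_j)\text{ with } w\in W_*,\ i,j\in S .$$ -/

import Mathlib

open Filter Topology MeasureTheory
open scoped ENNReal

noncomputable section

namespace SierpinskiGasket

variable {N : ℕ}

/-- The contraction `ψ_i(z) = (z + p_i) / 2` attached to the vertex `p i`. -/
def contr (p : Fin (N + 1) → EuclideanSpace ℝ (Fin N)) (i : Fin (N + 1))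
    (z : EuclideanSpace ℝ (Fin N)) : EuclideanSpace ℝ (Fin N) :=
  (2 : ℝ)⁻¹ • (z + p i)

/-- `ψ_w = ψ_{w₁} ∘ ⋯ ∘ ψ_{w_m}` for a word `w = w₁ ⋯ w_m`; the empty word gives the identity. -/
def contrWord (p : Fin (N + 1) → EuclideanSpace ℝ (Fin N)) :
    List (Fin (N + 1)) → EuclideanSpace ℝ (Fin N) → EuclideanSpace ℝ (Fin N)
  | [], z => z
  | i :: w, z => contr p i (contrWord p w z)

/-- The closed simplex with vertices `p i`. -/
def simplex (p : Fin (N + 1) → EuclideanSpace ℝ (Fin N)) : Set (EuclideanSpace ℝ (Fin N)) :=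
  convexHull ℝ (Set.range p)

/-- The Sierpinski gasket `K = ⋂_m ⋃_{|w| = m} ψ_w(simplex)`. -/
def gasket (p : Fin (N + 1) → EuclideanSpace ℝ (Fin N)) : Set (EuclideanSpace ℝ (Fin N)) :=
  ⋂ m : ℕ, ⋃ w ∈ {w : List (Fin (N + 1)) | w.length = m}, contrWord p w '' simplex p

/-- `V_m = ⋃_{|w| = m} ψ_w(V_0)`, where `V_0` is the set of vertices of the simplex. -/
def verts (p : Fin (N + 1) → EuclideanSpace ℝ (Fin N)) (m : ℕ) :
    Set (EuclideanSpace ℝ (Fin N)) :=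
  ⋃ w ∈ {w : List (Fin (N + 1)) | w.length = m}, contrWord p w '' Set.range p

/-- `V_* = ⋃_m V_m`. -/
def vertsStar (p : Fin (N + 1) → EuclideanSpace ℝ (Fin N)) : Set (EuclideanSpace ℝ (Fin N)) :=
  ⋃ m : ℕ, verts p m

theorem contrWord_append (p : Fin (N + 1) → EuclideanSpace ℝ (Fin N))
    (v w : List (Fin (N + 1))) (z : EuclideanSpace ℝ (Fin N)) :
    contrWord p (v ++ w) z = contrWord p v (contrWord p w z) := by
  induction v with
  | nil => rfl
  | cons i v ih => simp [contrWord, ih]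

theorem contrWord_replicate (p : Fin (N + 1) → EuclideanSpace ℝ (Fin N))
    (i : Fin (N + 1)) (n : ℕ) : contrWord p (List.replicate n i) (p i) = p i := by
  induction n with
  | zero => rfl
  | succ n ih =>
    rw [List.replicate_succ, contrWord, ih, contr, ← two_smul ℝ (p i), smul_smul]
    norm_num

theorem contrWord_mem_simplex (p : Fin (N + 1) → EuclideanSpace ℝ (Fin N))
    (w : List (Fin (N + 1))) {z : EuclideanSpace ℝ (Fin N)} (hz : z ∈ simplex p) :
    contrWord p w z ∈ simplex p := by
  induction w with
  | nil => exact hz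
  | cons i w ih =>
    have hi : p i ∈ simplex p := subset_convexHull ℝ _ (Set.mem_range_self i)
    have h := (convex_convexHull ℝ (Set.range p)) ih hi (a := (2 : ℝ)⁻¹) (b := (2 : ℝ)⁻¹)
      (by norm_num) (by norm_num) (by norm_num)
    rw [contrWord, contr, smul_add]
    exact h

theorem contrWord_mem_gasket (p : Fin (N + 1) → EuclideanSpace ℝ (Fin N))
    (w : List (Fin (N + 1))) (i : Fin (N + 1)) : contrWord p w (p i) ∈ gasket p := by
  refine Set.mem_iInter.2 fun m => ?_
  refine Set.mem_iUnion₂.2 ⟨(w ++ List.replicate m i).take m, ?_,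
    contrWord p ((w ++ List.replicate m i).drop m) (p i),
    contrWord_mem_simplex p _ (subset_convexHull ℝ _ (Set.mem_range_self i)), ?_⟩
  · simp
  · rw [← contrWord_append, List.take_append_drop, contrWord_append, contrWord_replicate]

theorem contrWord_mem_vertsStar (p : Fin (N + 1) → EuclideanSpace ℝ (Fin N))
    (w : List (Fin (N + 1))) (i : Fin (N + 1)) : contrWord p w (p i) ∈ vertsStar p :=
  Set.mem_iUnion.2 ⟨w.length, Set.mem_iUnion₂.2 ⟨w, rfl, p i, Set.mem_range_self i, rfl⟩⟩

theorem vertsStar_subset_gasket (p : Fin (N + 1) → EuclideanSpace ℝ (Fin N)) :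
    vertsStar p ⊆ gasket p := by
  intro x hx
  obtain ⟨m, hm⟩ := Set.mem_iUnion.1 hx
  obtain ⟨w, -, -, ⟨i, rfl⟩, rfl⟩ := Set.mem_iUnion₂.1 hm
  exact contrWord_mem_gasket p w i

/-- The point `ψ_w(p_i)` as an element of `V_*`. -/
def vertex (p : Fin (N + 1) → EuclideanSpace ℝ (Fin N)) (w : List (Fin (N + 1)))
    (i : Fin (N + 1)) : vertsStar p :=
  ⟨contrWord p w (p i), contrWord_mem_vertsStar p w i⟩

/-- The cell `K_w = ψ_w(K)`, as a subset of the space `K`. -/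
def cell (p : Fin (N + 1) → EuclideanSpace ℝ (Fin N)) (w : List (Fin (N + 1))) :
    Set (gasket p) :=
  {x | (x : EuclideanSpace ℝ (Fin N)) ∈ contrWord p w '' gasket p}

/-- The form `Q_0` on `l(V_0)`, functions on `V_0` being identified with functions of the index. -/
def formZero (f g : Fin (N + 1) → ℝ) : ℝ :=
  (1 / 2) * ∑ i, ∑ j, (f i - f j) * (g i - g j)

/-- `Q_m(f, g) = ∑_{|w| = m} Q_0(f ∘ ψ_w, g ∘ ψ_w)`. It depends only on the values on `V_m`. -/
def formLevel (p : Fin (N + 1) → EuclideanSpace ℝ (Fin N)) (m : ℕ) (f g : vertsStar p → ℝ) : ℝ :=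
  ∑ w : Fin m → Fin (N + 1),
    formZero (fun i => f (vertex p (List.ofFn w) i)) (fun i => g (vertex p (List.ofFn w) i))

/-- `E_*(f, f) ∈ [0, ∞]`: the limit of the nondecreasing sequence
`((N + 3) / (N + 1)) ^ m * Q_m(f, f)`, that is, its supremum. -/
def energyStar (p : Fin (N + 1) → EuclideanSpace ℝ (Fin N)) (f : vertsStar p → ℝ) : ℝ≥0∞ :=
  ⨆ m : ℕ, ENNReal.ofReal ((((N : ℝ) + 3) / ((N : ℝ) + 1)) ^ m * formLevel p m f f)

/-- The restriction to `V_*` of a continuous function on `K`. -/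
def restrictStar (p : Fin (N + 1) → EuclideanSpace ℝ (Fin N)) (f : C(gasket p, ℝ)) :
    vertsStar p → ℝ :=
  fun x => f (Set.inclusion (vertsStar_subset_gasket p) x)

/-- The domain `F` of the Dirichlet form: continuous functions on `K` of finite energy. -/
def domain (p : Fin (N + 1) → EuclideanSpace ℝ (Fin N)) : Set C(gasket p, ℝ) :=
  {f | energyStar p (restrictStar p f) < ∞}

/-- The Dirichlet form `E(f, g)`, obtained by polarization; it is meaningful for `f`, `g` in
`domain p`. -/
def energy (p : Fin (N + 1) → EuclideanSpace ℝ (Fin N)) (f g : C(gasket p, ℝ)) : ℝ :=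
  (1 / 2) * ((energyStar p (restrictStar p (f + g))).toReal
    - (energyStar p (restrictStar p f)).toReal - (energyStar p (restrictStar p g)).toReal)

/-- `ν` is the energy measure of `f`: a finite Borel measure on `K` with
`∫ g dν = 2 E(f, f g) - E(f², g)` for every `g` in the domain. -/
structure IsEnergyMeasure (p : Fin (N + 1) → EuclideanSpace ℝ (Fin N)) (f : C(gasket p, ℝ))
    (ν : Measure (gasket p)) : Prop where
  finite : IsFiniteMeasure ν
  integral_eq : ∀ g ∈ domain p, ∫ x, g x ∂ν = 2 * energy p f (f * g) - energy p (f ^ 2) g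

open Classical in
/-- The energy measure `ν_f` of `f` in the domain, i.e. the measure singled out by
`IsEnergyMeasure`. -/
def energyMeasure (p : Fin (N + 1) → EuclideanSpace ℝ (Fin N)) (f : C(gasket p, ℝ)) :
    Measure (gasket p) :=
  if h : ∃ ν, IsEnergyMeasure p f ν then h.choose else 0

/-- The vertex `p_i` as a point of `K`. -/
def corner (p : Fin (N + 1) → EuclideanSpace ℝ (Fin N)) (i : Fin (N + 1)) : gasket p :=
  ⟨p i, contrWord_mem_gasket p [] i⟩

/-- `h` is harmonic: it minimizes the energy among the functions in the domain with the same
values on `V_0`. -/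
def IsHarmonic (p : Fin (N + 1) → EuclideanSpace ℝ (Fin N)) (h : C(gasket p, ℝ)) : Prop :=
  h ∈ domain p ∧
    ∀ f ∈ domain p, (∀ i, f (corner p i) = h (corner p i)) → energy p h h ≤ energy p f f

open Classical in
/-- `ι(u)`: the harmonic function with values `u` on `V_0`. -/
def harmonicExt (p : Fin (N + 1) → EuclideanSpace ℝ (Fin N)) (u : Fin (N + 1) → ℝ) :
    C(gasket p, ℝ) :=
  if h : ∃ f, IsHarmonic p f ∧ ∀ i, f (corner p i) = u i then h.choose else 0

/-- The Kusuoka measure `ν = ∑_k ν_{h_k}` with `h_k = ι(e_k)`. -/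
def kusuoka (p : Fin (N + 1) → EuclideanSpace ℝ (Fin N)) : Measure (gasket p) :=
  ∑ k, energyMeasure p (harmonicExt p (Pi.single k 1))

/-- The quotient `ν_h(K_w) / ν(K_w)`. -/
def cellRatio (p : Fin (N + 1) → EuclideanSpace ℝ (Fin N)) (h : C(gasket p, ℝ))
    (w : List (Fin (N + 1))) : ℝ :=
  (energyMeasure p h).real (cell p w) / (kusuoka p).real (cell p w)

end SierpinskiGasket

end

noncomputable section

namespace SierpinskiGasket

variable {N : ℕ}

/-! A harmonic function is determined by its corner values u, and its values at the corners of K_w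
are A_w u, where the linear maps A_i (`cellVals`) are composed along w (`wordVals`). Write Q_0 for
`formZero` and s = (N+3)/(N+1). Then ν_h(K_w) = 2 s^|w| Q_0(A_w u)
(`IsEnergyMeasure.measureReal_cell`), so the ratio to be studied is Q_0(A_w u) / ∑_k Q_0(A_w e_k).

Fix a corner j. The map A_j fixes constants. On functions vanishing at j it has eigenvalue 1/s for
the function equal to 1 at all other corners, and the smaller eigenvalue 1/(N+3) on functions with
sum zero. The leading component is read off by flux_j(u) = ∑_k (u_k - u_j). Hence s^(2n) Q_0(A_j^n
u) tends to flux_j(u)²/N, and the ratio along w j^n tends to flux_j(A_w u)² / ∑_k flux_j(A_w e_k)².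
The denominator is positive because A_w is onto.

At the junction point ψ_{wi}(p_j) = ψ_{wj}(p_i) the normal derivatives from the two cells cancel,
that is, flux_j ∘ A_i = -flux_i ∘ A_j, and squaring removes the sign. Together with flux_i ∘ A_i =
s⁻¹ flux_i this makes the limit depend only on the point of V_* (`compatible_densityLimit`,
`Compatible.eq`).

The formula for ν_h(K_w) comes from testing against piecewise harmonic functions, whose integrals
are finite sums. They give an upper bound for each cell, and comparison with the total mass forces
equality. -/

/-! ### Linear algebra of the harmonic extension: fluxes and energies. -/

/-- The energy renormalization factor `(N + 3) / (N + 1)`. -/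
def scale (N : ℕ) : ℝ := ((N : ℝ) + 3) / ((N : ℝ) + 1)

theorem scale_pos : 0 < scale N := by unfold scale; positivity

theorem inv_scale_lt_one : (scale N)⁻¹ < 1 := by
  unfold scale
  rw [inv_div, div_lt_one (by positivity)]
  linarith

/-- The values at the vertices of the cell `i` of the harmonic function with boundary values `u`. -/
def cellVals (i : Fin (N + 1)) (u : Fin (N + 1) → ℝ) : Fin (N + 1) → ℝ :=
  fun j => if j = i then u i else (u i + u j + ∑ k, u k) / ((N : ℝ) + 3)

/-- The values at the vertices of the cell `w` of the harmonic function with boundary values `u`. -/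
def wordVals : List (Fin (N + 1)) → (Fin (N + 1) → ℝ) → Fin (N + 1) → ℝ
  | [], u => u
  | i :: w, u => wordVals w (cellVals i u)

theorem wordVals_append (v w : List (Fin (N + 1))) (u : Fin (N + 1) → ℝ) :
    wordVals (v ++ w) u = wordVals w (wordVals v u) := by
  induction v generalizing u with
  | nil => rfl
  | cons i v ih => simp [wordVals, ih]

theorem wordVals_concat (v : List (Fin (N + 1))) (i : Fin (N + 1)) (u : Fin (N + 1) → ℝ) :
    wordVals (v ++ [i]) u = cellVals i (wordVals v u) := by
  rw [wordVals_append]; rfl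

/-- The normal derivative at the vertex `j`, up to sign. -/
def flux (j : Fin (N + 1)) (u : Fin (N + 1) → ℝ) : ℝ := ∑ k, (u k - u j)

@[simp] theorem cellVals_self (i : Fin (N + 1)) (u : Fin (N + 1) → ℝ) :
    cellVals i u i = u i := by simp [cellVals]

theorem cellVals_comm (i j : Fin (N + 1)) (u : Fin (N + 1) → ℝ) :
    cellVals i u j = cellVals j u i := by
  unfold cellVals
  by_cases h : j = i
  · subst h; rfl
  · rw [if_neg h, if_neg (Ne.symm h), add_comm (u i)]

theorem flux_eq (j : Fin (N + 1)) (u : Fin (N + 1) → ℝ) :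
    flux j u = ∑ k, u k - ((N : ℝ) + 1) * u j := by
  simp [flux, Finset.sum_sub_distrib]

theorem cellVals_sub (i j : Fin (N + 1)) (u : Fin (N + 1) → ℝ) :
    cellVals i u j - u i =
      ((u j - u i) + flux i u) / ((N : ℝ) + 3) - if j = i then flux i u / ((N : ℝ) + 3) else 0 := by
  unfold cellVals
  have h3 : (N : ℝ) + 3 ≠ 0 := by positivity
  split_ifs with h
  · subst h; simp
  · rw [flux_eq]; field_simp; ring

theorem sum_cellVals_sub (i : Fin (N + 1)) (u : Fin (N + 1) → ℝ) :
    ∑ j, (cellVals i u j - u i) = (scale N)⁻¹ * flux i u := by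
  simp only [cellVals_sub, Finset.sum_sub_distrib, ← Finset.sum_div, Finset.sum_add_distrib,
    Finset.sum_ite_eq', Finset.mem_univ, if_true]
  rw [← Finset.sum_sub_distrib, show ∑ k, (u k - u i) = flux i u from rfl, scale]
  have h3 : (N : ℝ) + 3 ≠ 0 := by positivity
  have h1 : (N : ℝ) + 1 ≠ 0 := by positivity
  simp
  field_simp
  ring

theorem flux_cellVals_self (i : Fin (N + 1)) (u : Fin (N + 1) → ℝ) :
    flux i (cellVals i u) = (scale N)⁻¹ * flux i u := by
  rw [← sum_cellVals_sub, flux, cellVals_self]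

theorem flux_cellVals {i j : Fin (N + 1)} (hij : j ≠ i) (u : Fin (N + 1) → ℝ) :
    flux j (cellVals i u) = (scale N)⁻¹ * (u i - u j) := by
  have h : flux j (cellVals i u) =
      ∑ k, (cellVals i u k - u i) - ((N : ℝ) + 1) * (cellVals i u j - u i) := by
    rw [flux_eq]; simp [Finset.sum_sub_distrib]; ring
  rw [h, sum_cellVals_sub, cellVals_sub, if_neg hij, scale]
  have h3 : (N : ℝ) + 3 ≠ 0 := by positivity
  have h1 : (N : ℝ) + 1 ≠ 0 := by positivity
  field_simp
  ring

/-- Kirchhoff's law at the interior junction point of the cells i and j. It is the reason why the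
two limits of the theorem coincide. -/
theorem flux_cellVals_antisymm {i j : Fin (N + 1)} (hij : j ≠ i) (u : Fin (N + 1) → ℝ) :
    flux j (cellVals i u) = -flux i (cellVals j u) := by
  rw [flux_cellVals hij, flux_cellVals hij.symm]; ring

theorem formZero_eq_flux (f g : Fin (N + 1) → ℝ) : formZero f g = -∑ k, flux k f * g k := by
  have h1 : ∑ i, ∑ j, (f i - f j) * (g i - g j) =
      -∑ i, ∑ j, (f j - f i) * g i - ∑ i, ∑ j, (f i - f j) * g j := by
    simp only [← Finset.sum_neg_distrib, ← Finset.sum_sub_distrib]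
    exact Finset.sum_congr rfl fun i _ => Finset.sum_congr rfl fun j _ => by ring
  have h2 : ∑ i, ∑ j, (f i - f j) * g j = ∑ i, ∑ j, (f j - f i) * g i := Finset.sum_comm
  rw [formZero, h1, h2]
  simp only [flux, Finset.sum_mul]
  ring

theorem formZero_comm (f g : Fin (N + 1) → ℝ) : formZero f g = formZero g f := by
  unfold formZero
  simp only [mul_comm]

theorem formZero_nonneg (f : Fin (N + 1) → ℝ) : 0 ≤ formZero f f := by
  unfold formZero
  exact mul_nonneg (by norm_num)
    (Finset.sum_nonneg fun i _ => Finset.sum_nonneg fun j _ => mul_self_nonneg _)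

theorem formZero_sub_sub (f g : Fin (N + 1) → ℝ) :
    formZero (f - g) (f - g) = formZero f f - 2 * formZero g f + formZero g g := by
  unfold formZero
  simp only [Finset.mul_sum, ← Finset.sum_sub_distrib, ← Finset.sum_add_distrib, Pi.sub_apply]
  exact Finset.sum_congr rfl fun i _ => Finset.sum_congr rfl fun j _ => by ring

theorem eq_of_formZero_eq_zero {f : Fin (N + 1) → ℝ} (h : formZero f f = 0) (i j : Fin (N + 1)) :
    f i = f j := by
  have h1 : ∑ i, ∑ j, (f i - f j) * (f i - f j) = 0 := by
    unfold formZero at h; linarith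
  have h2 := (Finset.sum_eq_zero_iff_of_nonneg fun i _ =>
    Finset.sum_nonneg fun j _ => mul_self_nonneg _).1 h1 i (Finset.mem_univ i)
  have h3 := (Finset.sum_eq_zero_iff_of_nonneg fun j _ => mul_self_nonneg _).1 h2 j
    (Finset.mem_univ j)
  exact sub_eq_zero.1 (mul_self_eq_zero.1 h3)

/-- **Green's identity**: harmonic functions are orthogonal to functions vanishing on `V_0`. -/
theorem sum_formZero_cellVals (u : Fin (N + 1) → ℝ) (G : Fin (N + 1) → Fin (N + 1) → ℝ)
    (hG : ∀ i j, G i j = G j i) :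
    scale N * ∑ i, formZero (cellVals i u) (G i) = formZero u (fun i => G i i) := by
  have hs : scale N ≠ 0 := scale_pos.ne'
  have key : ∑ i, ∑ j, flux j (cellVals i u) * G i j = (scale N)⁻¹ * ∑ i, flux i u * G i i := by
    have h1 : ∀ i j, flux j (cellVals i u) * G i j =
        (if i = j then (scale N)⁻¹ * (flux i u * G i i) else 0)
          + (scale N)⁻¹ * ((u i - u j) * G i j) := by
      intro i j
      split_ifs with h
      · subst h; rw [flux_cellVals_self]; ring
      · rw [flux_cellVals (Ne.symm h)]; ring
    -- The contributions of the junction points cancel in pairs: fluxes are antisymmetric in i and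
    -- j, values of G are symmetric.
    have h2 : ∑ i, ∑ j, (u i - u j) * G i j = 0 := by
      have : ∑ i, ∑ j, (u i - u j) * G i j = -∑ i, ∑ j, (u i - u j) * G i j := by
        conv_lhs => rw [Finset.sum_comm]
        simp only [← Finset.sum_neg_distrib]
        exact Finset.sum_congr rfl fun i _ => Finset.sum_congr rfl fun j _ => by
          rw [hG j i]; ring
      linarith
    simp only [h1, Finset.sum_add_distrib, ← Finset.mul_sum, h2, Finset.sum_ite_eq,
      Finset.mem_univ, if_true, mul_zero, add_zero]
  simp only [formZero_eq_flux, Finset.sum_neg_distrib, key]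
  field_simp

/-- Pythagoras from Green's identity: the deviation from the harmonic extension is orthogonal to it,
so its energy is exactly the excess over the minimum. -/
theorem scale_mul_sum_formZero (u : Fin (N + 1) → ℝ) (G : Fin (N + 1) → Fin (N + 1) → ℝ)
    (hG : ∀ i j, G i j = G j i) (hu : ∀ i, G i i = u i) :
    scale N * ∑ i, formZero (G i) (G i) =
      formZero u u + scale N * ∑ i, formZero (G i - cellVals i u) (G i - cellVals i u) := by
  have h1 := sum_formZero_cellVals u G hG
  have h2 := sum_formZero_cellVals u (fun i => cellVals i u) (fun i j => cellVals_comm i j u)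
  simp only [cellVals_self] at h2
  simp only [hu] at h1
  simp only [formZero_sub_sub, Finset.sum_sub_distrib, Finset.sum_add_distrib, ← Finset.mul_sum,
    mul_sub, mul_add]
  linarith

theorem formZero_eq_sum_sq (c : ℝ) (v : Fin (N + 1) → ℝ) :
    formZero v v = ((N : ℝ) + 1) * ∑ k, (v k - c) ^ 2 - (∑ k, (v k - c)) ^ 2 := by
  have h : ∑ i, ∑ j, (v i - v j) * (v i - v j) = ∑ i, ∑ j, ((v i - c) ^ 2 + (v j - c) ^ 2
      - 2 * ((v i - c) * (v j - c))) :=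
    Finset.sum_congr rfl fun i _ => Finset.sum_congr rfl fun j _ => by ring
  rw [formZero, h]
  simp only [Finset.sum_sub_distrib, Finset.sum_add_distrib, ← Finset.mul_sum, ← Finset.sum_mul,
    Finset.sum_const, Finset.card_univ, Fintype.card_fin, nsmul_eq_mul]
  push_cast
  ring

/-- The sum of the squared differences to the vertex `i`. -/
def sqSum (i : Fin (N + 1)) (u : Fin (N + 1) → ℝ) : ℝ := ∑ k, (u k - u i) ^ 2

theorem formZero_eq_sqSum (i : Fin (N + 1)) (u : Fin (N + 1) → ℝ) :
    formZero u u = ((N : ℝ) + 1) * sqSum i u - flux i u ^ 2 :=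
  formZero_eq_sum_sq (u i) u

theorem sqSum_cellVals (i : Fin (N + 1)) (u : Fin (N + 1) → ℝ) :
    sqSum i (cellVals i u) =
      (sqSum i u + ((N : ℝ) + 2) * flux i u ^ 2) / ((N : ℝ) + 3) ^ 2 := by
  have h : ∀ k, (cellVals i u k - u i) ^ 2 =
      ((u k - u i) ^ 2 + 2 * flux i u * (u k - u i) + flux i u ^ 2) / ((N : ℝ) + 3) ^ 2
        - if k = i then flux i u ^ 2 / ((N : ℝ) + 3) ^ 2 else 0 := by
    intro k
    rw [cellVals_sub]
    split_ifs with hk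
    · subst hk; ring
    · rw [sub_zero, sub_zero, div_pow]; ring
  rw [sqSum, cellVals_self]
  simp only [h, Finset.sum_sub_distrib, ← Finset.sum_div, Finset.sum_add_distrib, ← Finset.mul_sum,
    Finset.sum_ite_eq', Finset.mem_univ, if_true]
  rw [← Finset.sum_sub_distrib, show ∑ k, (u k - u i) = flux i u from rfl,
    show ∑ k, (u k - u i) ^ 2 = sqSum i u from rfl]
  simp
  ring

/-- Cauchy–Schwarz over the N indices other than i. The constant N, rather than N + 1, is sharp and
is what the energy decay below requires. -/
theorem sq_flux_le (i : Fin (N + 1)) (u : Fin (N + 1) → ℝ) :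
    flux i u ^ 2 ≤ (N : ℝ) * sqSum i u := by
  have h1 : flux i u = ∑ k ∈ Finset.univ.erase i, (u k - u i) :=
    (Finset.sum_erase _ (by simp)).symm
  have h2 : sqSum i u = ∑ k ∈ Finset.univ.erase i, (u k - u i) ^ 2 :=
    (Finset.sum_erase _ (by simp)).symm
  rw [h1, h2]
  refine sq_sum_le_card_mul_sum_sq.trans_eq ?_
  simp

theorem formZero_cellVals (i : Fin (N + 1)) (u : Fin (N + 1) → ℝ) :
    formZero (cellVals i u) (cellVals i u) =
      ((N : ℝ) + 1) * (sqSum i u + flux i u ^ 2) / ((N : ℝ) + 3) ^ 2 := by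
  rw [formZero_eq_sqSum i, sqSum_cellVals, flux_cellVals_self, scale]
  have h3 : (N : ℝ) + 3 ≠ 0 := by positivity
  have h1 : (N : ℝ) + 1 ≠ 0 := by positivity
  field_simp
  ring

/-- Equivalent to `sq_flux_le`. The extreme case is the leading eigenvector of A_i, equal at all
corners other than i. -/
theorem scale_mul_formZero_cellVals_le (i : Fin (N + 1)) (u : Fin (N + 1) → ℝ) :
    scale N * formZero (cellVals i u) (cellVals i u) ≤ (scale N)⁻¹ * formZero u u := by
  rw [formZero_cellVals, formZero_eq_sqSum i, scale, inv_div]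
  have h := sq_flux_le i u
  have h3 : (0 : ℝ) < (N : ℝ) + 3 := by positivity
  have h1 : (0 : ℝ) < (N : ℝ) + 1 := by positivity
  have e : ((N : ℝ) + 3) / (N + 1) * ((N + 1) * (sqSum i u + flux i u ^ 2) / (N + 3) ^ 2) =
      (sqSum i u + flux i u ^ 2) / (N + 3) := by field_simp
  rw [e, div_mul_eq_mul_div]
  refine div_le_div_of_nonneg_right ?_ h3.le
  have h0 : (0 : ℝ) ≤ N := by positivity
  nlinarith [mul_nonneg h0 (sub_nonneg.2 h)]

theorem sq_flux_le_formZero (i : Fin (N + 1)) (u : Fin (N + 1) → ℝ) :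
    flux i u ^ 2 ≤ (N : ℝ) * formZero u u := by
  rw [formZero_eq_sqSum i]
  have h := sq_flux_le i u
  have h0 : (0 : ℝ) ≤ N := by positivity
  nlinarith [mul_nonneg h0 (sub_nonneg.2 h)]

/-! ### Energy along j^n and invertibility of the maps A_w. -/

/-- Spectral decomposition of A_j. After subtracting u_j, `sqSum j u - flux j u ^ 2 / N` is the
squared norm of the sum-zero part, whose eigenvalue 1/(N+3) becomes 1/(N+1) after multiplication by
`scale N`. -/
theorem formZero_wordVals_replicate (hN : N ≠ 0) (j : Fin (N + 1)) (n : ℕ)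
    (u : Fin (N + 1) → ℝ) :
    (scale N ^ 2) ^ n *
        formZero (wordVals (List.replicate n j) u) (wordVals (List.replicate n j) u) =
      flux j u ^ 2 / N +
        ((N : ℝ) + 1) * (sqSum j u - flux j u ^ 2 / N) * ((((N : ℝ) + 1) ^ 2)⁻¹) ^ n := by
  have hN' : (N : ℝ) ≠ 0 := Nat.cast_ne_zero.2 hN
  have h3 : (N : ℝ) + 3 ≠ 0 := by positivity
  have h1 : (N : ℝ) + 1 ≠ 0 := by positivity
  induction n generalizing u with
  | zero =>
    simp only [pow_zero, List.replicate_zero, wordVals, formZero_eq_sqSum j]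
    field_simp
    ring
  | succ n ih =>
    rw [List.replicate_succ, wordVals, pow_succ', mul_assoc, ih, sqSum_cellVals,
      flux_cellVals_self, pow_succ ((((N : ℝ) + 1) ^ 2)⁻¹) n, scale]
    generalize ((((N : ℝ) + 1) ^ 2)⁻¹) ^ n = x
    field_simp
    ring

theorem tendsto_formZero_wordVals_replicate (hN : N ≠ 0) (j : Fin (N + 1))
    (u : Fin (N + 1) → ℝ) :
    Tendsto (fun n : ℕ => (scale N ^ 2) ^ n *
        formZero (wordVals (List.replicate n j) u) (wordVals (List.replicate n j) u))
      atTop (𝓝 (flux j u ^ 2 / N)) := by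
  have h0 : (0 : ℝ) < N := by positivity
  have h : Tendsto (fun n : ℕ => ((((N : ℝ) + 1) ^ 2)⁻¹) ^ n) atTop (𝓝 0) :=
    tendsto_pow_atTop_nhds_zero_of_lt_one (by positivity) (inv_lt_one_of_one_lt₀ (by nlinarith))
  simp only [formZero_wordVals_replicate hN]
  simpa using (h.const_mul _).const_add (flux j u ^ 2 / N)

theorem cellVals_surjective (i : Fin (N + 1)) :
    Function.Surjective (cellVals (N := N) i) := by
  intro v
  have h3 : (N : ℝ) + 3 ≠ 0 := by positivity
  have h1 : (N : ℝ) + 1 ≠ 0 := by positivity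
  -- Obtained by solving `cellVals_sub` for u, knowing that the flux of u at i must be `scale N *
  -- flux i v`; the last term corrects the entry at i.
  set u : Fin (N + 1) → ℝ := fun k => v i + (((N : ℝ) + 3) * (v k - v i) - scale N * flux i v
    + if k = i then scale N * flux i v else 0) with hu
  have hui : u i = v i := by simp [hu]
  have hf : flux i u = scale N * flux i v := by
    rw [flux, hui]
    simp only [hu, add_sub_cancel_left, Finset.sum_add_distrib, Finset.sum_sub_distrib,
      ← Finset.mul_sum, Finset.sum_ite_eq', Finset.mem_univ, if_true]
    rw [← Finset.sum_sub_distrib, show ∑ k, (v k - v i) = flux i v from rfl, scale]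
    simp
    field_simp
    ring
  refine ⟨u, funext fun j => ?_⟩
  have h := cellVals_sub i j u
  rw [hf, hui] at h
  have : cellVals i u j - v i = v j - v i := by
    rw [h]
    split_ifs with hj
    · subst hj; rw [hui]; simp
    · simp only [hu, if_neg hj]; field_simp; ring
  linarith

theorem wordVals_surjective (w : List (Fin (N + 1))) :
    Function.Surjective (wordVals (N := N) w) := by
  induction w with
  | nil => exact Function.surjective_id
  | cons i w ih => exact ih.comp (cellVals_surjective i)

theorem cellVals_add (i : Fin (N + 1)) (u v : Fin (N + 1) → ℝ) :
    cellVals i (u + v) = cellVals i u + cellVals i v := by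
  funext j
  simp only [cellVals, Pi.add_apply, Finset.sum_add_distrib]
  split_ifs
  · rfl
  · ring

theorem cellVals_smul (i : Fin (N + 1)) (c : ℝ) (u : Fin (N + 1) → ℝ) :
    cellVals i (c • u) = c • cellVals i u := by
  funext j
  simp only [cellVals, Pi.smul_apply, smul_eq_mul, ← Finset.mul_sum]
  split_ifs
  · rfl
  · ring

/-- `wordVals` as a linear map. -/
def wordValsLin (w : List (Fin (N + 1))) : (Fin (N + 1) → ℝ) →ₗ[ℝ] (Fin (N + 1) → ℝ) where
  toFun := wordVals w
  map_add' u v := by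
    induction w generalizing u v with
    | nil => rfl
    | cons i w ih => simp only [wordVals, cellVals_add, ih]
  map_smul' c u := by
    induction w generalizing u with
    | nil => rfl
    | cons i w ih => simp only [wordVals, cellVals_smul, ih, RingHom.id_apply] at ih ⊢

/-- `flux j` as a linear map. -/
def fluxLin (j : Fin (N + 1)) : (Fin (N + 1) → ℝ) →ₗ[ℝ] ℝ where
  toFun := flux j
  map_add' u v := by
    simp only [flux, Pi.add_apply, ← Finset.sum_add_distrib]
    exact Finset.sum_congr rfl fun _ _ => by ring
  map_smul' c u := by
    simp only [flux, Pi.smul_apply, smul_eq_mul, Finset.mul_sum, RingHom.id_apply]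
    exact Finset.sum_congr rfl fun _ _ => by ring

/-- Otherwise the functional flux_j ∘ A_w vanishes on a basis, although A_w is onto and flux_j(e_j)
= -N. -/
theorem exists_flux_wordVals_single_ne_zero (hN : N ≠ 0) (w : List (Fin (N + 1)))
    (j : Fin (N + 1)) : ∃ k, flux j (wordVals w (Pi.single k 1)) ≠ 0 := by
  by_contra! h
  have h0 : (fluxLin j).comp (wordValsLin w) = 0 := LinearMap.pi_ext' fun k =>
    LinearMap.ext_ring (h k)
  obtain ⟨u, hu⟩ := wordVals_surjective w (Pi.single j 1)
  have h1 : flux j (wordVals w u) = 0 := LinearMap.congr_fun h0 u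
  rw [hu, flux_eq] at h1
  simp at h1
  exact hN h1

theorem sum_sq_flux_wordVals_pos (hN : N ≠ 0) (w : List (Fin (N + 1))) (j : Fin (N + 1)) :
    0 < ∑ k, flux j (wordVals w (Pi.single k 1)) ^ 2 := by
  obtain ⟨k, hk⟩ := exists_flux_wordVals_single_ne_zero hN w j
  exact Finset.sum_pos' (fun _ _ => sq_nonneg _) ⟨k, Finset.mem_univ k, by positivity⟩

theorem sum_formZero_wordVals_pos (hN : N ≠ 0) (w : List (Fin (N + 1))) :
    0 < ∑ k, formZero (wordVals w (Pi.single k 1)) (wordVals w (Pi.single k 1)) := by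
  have h := sum_sq_flux_wordVals_pos hN w 0
  have h2 : ∑ k, flux 0 (wordVals w (Pi.single k 1)) ^ 2 ≤
      N * ∑ k, formZero (wordVals w (Pi.single k 1)) (wordVals w (Pi.single k 1)) := by
    rw [Finset.mul_sum]
    exact Finset.sum_le_sum fun k _ => sq_flux_le_formZero _ _
  exact pos_of_mul_pos_right (h.trans_le h2) (by positivity)

/-! ### Maximum principle, decay of oscillation and of energy. -/

/-- Each new value is a convex combination of the old ones: the weights in the numerator add up to N
+ 3. -/
theorem cellVals_mem_Icc {a b : ℝ} {u : Fin (N + 1) → ℝ} (hu : ∀ k, u k ∈ Set.Icc a b)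
    (i j : Fin (N + 1)) : cellVals i u j ∈ Set.Icc a b := by
  unfold cellVals
  split_ifs
  · exact hu i
  · have h1 : ((N : ℝ) + 1) * a ≤ ∑ k, u k := by
      simpa using Finset.card_nsmul_le_sum Finset.univ u a fun k _ => (hu k).1
    have h2 : ∑ k, u k ≤ ((N : ℝ) + 1) * b := by
      simpa using Finset.sum_le_card_nsmul Finset.univ u b fun k _ => (hu k).2
    have h3 : (0 : ℝ) < (N : ℝ) + 3 := by positivity
    constructor
    · rw [le_div_iff₀ h3]; linarith [(hu i).1, (hu j).1]
    · rw [div_le_iff₀ h3]; linarith [(hu i).2, (hu j).2]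

theorem wordVals_mem_Icc {a b : ℝ} (w : List (Fin (N + 1))) {u : Fin (N + 1) → ℝ}
    (hu : ∀ k, u k ∈ Set.Icc a b) (j : Fin (N + 1)) : wordVals w u j ∈ Set.Icc a b := by
  induction w generalizing u with
  | nil => exact hu j
  | cons i w ih => exact ih fun k => cellVals_mem_Icc hu i k

theorem abs_cellVals_sub_le {M : ℝ} {u : Fin (N + 1) → ℝ} (hu : ∀ j k, |u j - u k| ≤ M)
    (i j k : Fin (N + 1)) : |cellVals i u j - cellVals i u k| ≤ (scale N)⁻¹ * M := by
  have h3 : (0 : ℝ) < (N : ℝ) + 3 := by positivity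
  have hM : 0 ≤ M := (abs_nonneg _).trans (hu 0 0)
  have hf : |flux i u| ≤ N * M := by
    rw [flux, ← Finset.sum_erase Finset.univ (a := i) (sub_self (u i))]
    refine (Finset.abs_sum_le_sum_abs _ _).trans ?_
    refine (Finset.sum_le_card_nsmul _ _ M fun k _ => hu k i).trans_eq ?_
    simp
  have e : cellVals i u j - cellVals i u k =
      (cellVals i u j - u i) - (cellVals i u k - u i) := by ring
  have hj := abs_le.1 (hu j i)
  have hk := abs_le.1 (hu k i)
  have hjk := abs_le.1 (hu j k)
  have hN0 : (0 : ℝ) ≤ N * M := by positivity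
  have hf' := abs_le.1 hf
  have key : ∀ x y : ℝ, y = x / ((N : ℝ) + 3) → |x| ≤ (N + 1) * M → |y| ≤ (scale N)⁻¹ * M := by
    intro x y hy hx
    rw [hy, scale, inv_div, div_mul_eq_mul_div, abs_div, abs_of_pos h3]
    exact div_le_div_of_nonneg_right hx h3.le
  rw [e, cellVals_sub, cellVals_sub]
  by_cases h1 : j = i <;> by_cases h2 : k = i
  · exact key 0 _ (by simp [h1, h2]) (by rw [abs_zero]; positivity)
  · refine key (-((u k - u i) + flux i u)) _ (by simp [h1, h2]; ring) ?_
    rw [abs_neg, abs_le]; constructor <;> linarith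
  · refine key ((u j - u i) + flux i u) _ (by simp [h1, h2]) ?_
    rw [abs_le]; constructor <;> linarith
  · refine key (u j - u k) _ (by simp [h1, h2]; ring) ?_
    rw [abs_le]; constructor <;> linarith

theorem abs_wordVals_sub_le {M : ℝ} (w : List (Fin (N + 1))) {u : Fin (N + 1) → ℝ}
    (hu : ∀ j k, |u j - u k| ≤ M) (j k : Fin (N + 1)) :
    |wordVals w u j - wordVals w u k| ≤ (scale N)⁻¹ ^ w.length * M := by
  induction w generalizing u M with
  | nil => simpa [wordVals] using hu j k
  | cons i w ih =>
    rw [List.length_cons, pow_succ, mul_assoc]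
    exact ih (abs_cellVals_sub_le hu i)

theorem scale_pow_mul_formZero_wordVals_le (w : List (Fin (N + 1))) (u : Fin (N + 1) → ℝ) :
    scale N ^ w.length * formZero (wordVals w u) (wordVals w u) ≤
      (scale N)⁻¹ ^ w.length * formZero u u := by
  induction w generalizing u with
  | nil => simp [wordVals]
  | cons i w ih =>
    rw [List.length_cons, wordVals, pow_succ', pow_succ, mul_assoc, mul_assoc]
    calc scale N * (scale N ^ w.length * _)
        ≤ scale N * ((scale N)⁻¹ ^ w.length * formZero (cellVals i u) (cellVals i u)) :=
          mul_le_mul_of_nonneg_left (ih _) scale_pos.le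
      _ = (scale N)⁻¹ ^ w.length * (scale N * formZero (cellVals i u) (cellVals i u)) := by ring
      _ ≤ _ := mul_le_mul_of_nonneg_left (scale_mul_formZero_cellVals_le i u)
          (pow_nonneg (inv_nonneg.2 scale_pos.le) _)

/-! ### Intersections of cells. -/

theorem exists_weights {p : Fin (N + 1) → EuclideanSpace ℝ (Fin N)}
    {x : EuclideanSpace ℝ (Fin N)} (hx : x ∈ simplex p) :
    ∃ a : Fin (N + 1) → ℝ, (∀ i, 0 ≤ a i) ∧ ∑ i, a i = 1 ∧ ∑ i, a i • p i = x := by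
  rw [simplex, convexHull_range_eq_exists_affineCombination] at hx
  obtain ⟨s, w, hw0, hw1, rfl⟩ := hx
  refine ⟨fun i => if i ∈ s then w i else 0, fun i => ?_, ?_, ?_⟩
  · dsimp only; split_ifs with h
    exacts [hw0 i h, le_rfl]
  · simpa using hw1
  · rw [s.affineCombination_eq_linear_combination _ _ hw1]
    simp [ite_smul]

theorem vertex_mem_simplex (p : Fin (N + 1) → EuclideanSpace ℝ (Fin N)) (i : Fin (N + 1)) :
    p i ∈ simplex p := subset_convexHull ℝ _ (Set.mem_range_self i)

theorem contr_self (p : Fin (N + 1) → EuclideanSpace ℝ (Fin N)) (i : Fin (N + 1)) :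
    contr p i (p i) = p i := by
  have := contrWord_replicate p i 1
  simpa [contrWord] using this

theorem contr_comm (p : Fin (N + 1) → EuclideanSpace ℝ (Fin N)) (i j : Fin (N + 1)) :
    contr p i (p j) = contr p j (p i) := by
  rw [contr, contr, add_comm]

theorem contr_injective (p : Fin (N + 1) → EuclideanSpace ℝ (Fin N)) (i : Fin (N + 1)) :
    Function.Injective (contr p i) := by
  intro x y h
  have h2 : (2 : ℝ)⁻¹ ≠ 0 := by norm_num
  simpa [contr, h2] using h

/-- Two distinct first-level cells meet only at a vertex of both. -/
theorem eq_of_contr_eq_contr {p : Fin (N + 1) → EuclideanSpace ℝ (Fin N)}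
    (hp : AffineIndependent ℝ p) {i j : Fin (N + 1)} (hij : i ≠ j)
    {x y : EuclideanSpace ℝ (Fin N)} (hx : x ∈ simplex p) (hy : y ∈ simplex p)
    (h : contr p i x = contr p j y) : x = p j := by
  obtain ⟨a, ha0, ha1, rfl⟩ := exists_weights hx
  obtain ⟨b, hb0, hb1, rfl⟩ := exists_weights hy
  have h2 : (2 : ℝ)⁻¹ ≠ 0 := by norm_num
  have hsum : ∑ k, a k • p k + p i = ∑ k, b k • p k + p j :=
    smul_right_injective _ h2 h
  rw [affineIndependent_iff] at hp
  -- Uniqueness of barycentric coordinates gives a + e_i = b + e_j. At the index j this reads a_j =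
  -- b_j + 1, so a is concentrated at j.
  have hz := hp Finset.univ
    (fun k => (a k + (Pi.single i 1 : Fin (N + 1) → ℝ) k)
      - (b k + (Pi.single j 1 : Fin (N + 1) → ℝ) k))
    (by simp [Finset.sum_sub_distrib, Finset.sum_add_distrib, ha1, hb1])
    (by
      simp only [sub_smul, add_smul, Finset.sum_sub_distrib, Finset.sum_add_distrib]
      simp only [Pi.single_apply, ite_smul, one_smul, zero_smul, Finset.sum_ite_eq',
        Finset.mem_univ, if_true]
      rw [hsum, sub_self])
  have hj := hz j (Finset.mem_univ j)
  simp only [Pi.single_apply, hij.symm, if_true, if_false] at hj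
  have haj : 1 ≤ a j := by linarith [hb0 j]
  have h0 : ∀ k, k ≠ j → a k = 0 := by
    intro k hk
    have h1 : a k + a j ≤ 1 := by
      rw [← ha1, ← Finset.sum_pair hk]
      exact Finset.sum_le_sum_of_subset_of_nonneg (Finset.subset_univ _) fun l _ _ => ha0 l
    linarith [ha0 k]
  have hj1 : a j = 1 := by
    rw [← ha1, Finset.sum_eq_single j (fun k _ hk => h0 k hk) (by simp)]
  rw [Finset.sum_eq_single j (fun k _ hk => by rw [h0 k hk, zero_smul]) (by simp), hj1, one_smul]

/-- By `eq_of_contr_eq_contr`, a first-level cell other than j cannot contain p_j; peeling off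
letters one by one finishes. -/
theorem contrWord_eq_vertex {p : Fin (N + 1) → EuclideanSpace ℝ (Fin N)}
    (hp : AffineIndependent ℝ p) {w : List (Fin (N + 1))} {j : Fin (N + 1)}
    {x : EuclideanSpace ℝ (Fin N)} (hx : x ∈ simplex p) (h : contrWord p w x = p j) :
    w = List.replicate w.length j ∧ x = p j := by
  induction w with
  | nil => exact ⟨rfl, h⟩
  | cons i w ih =>
    have hij : i = j := by
      by_contra hij
      have h' := eq_of_contr_eq_contr hp (Ne.symm hij) (vertex_mem_simplex p j)
        (contrWord_mem_simplex p w hx) ((contr_self p j).trans h.symm)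
      exact hij (hp.injective h').symm
    subst hij
    obtain ⟨h1, h2⟩ := ih (contr_injective p i (h.trans (contr_self p i).symm))
    refine ⟨?_, h2⟩
    rw [List.length_cons, List.replicate_succ, ← h1]

/-- Cells of which neither contains the other meet only at common vertices. -/
theorem eq_vertex_of_contrWord_eq {p : Fin (N + 1) → EuclideanSpace ℝ (Fin N)}
    (hp : AffineIndependent ℝ p) {v w : List (Fin (N + 1))} (hvw : ¬ v <+: w) (hwv : ¬ w <+: v)
    {x y : EuclideanSpace ℝ (Fin N)} (hx : x ∈ simplex p) (hy : y ∈ simplex p)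
    (h : contrWord p v x = contrWord p w y) : ∃ i, x = p i := by
  induction v generalizing w with
  | nil => exact absurd List.nil_prefix hvw
  | cons a v ih =>
    cases w with
    | nil => exact absurd List.nil_prefix hwv
    | cons b w =>
      by_cases hab : a = b
      · subst hab
        refine ih (fun hh => hvw ?_) (fun hh => hwv ?_) (contr_injective p a h)
        · exact List.cons_prefix_cons.2 ⟨rfl, hh⟩
        · exact List.cons_prefix_cons.2 ⟨rfl, hh⟩
      · have h1 := eq_of_contr_eq_contr hp hab (contrWord_mem_simplex p v hx)
          (contrWord_mem_simplex p w hy) h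
        exact ⟨b, (contrWord_eq_vertex hp hx h1).2⟩

/-- At a common point of first-level cells a ≠ b, the index of the corner is b seen from a and a
seen from b, so equal indices are impossible. Hence a point is the k-th corner of at most one cell
per level, which bounds the number of neighbours of a cell. -/
theorem word_eq_of_contrWord_eq {p : Fin (N + 1) → EuclideanSpace ℝ (Fin N)}
    (hp : AffineIndependent ℝ p) {v w : List (Fin (N + 1))} (hl : v.length = w.length)
    {k : Fin (N + 1)} (h : contrWord p v (p k) = contrWord p w (p k)) : v = w := by
  induction v generalizing w with
  | nil => exact (List.length_eq_zero_iff.1 hl.symm).symm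
  | cons a v ih =>
    cases w with
    | nil => simp at hl
    | cons b w =>
      by_cases hab : a = b
      · subst hab
        rw [ih (by simpa using hl) (contr_injective p a h)]
      · have hv := contrWord_mem_simplex p v (vertex_mem_simplex p k)
        have hw := contrWord_mem_simplex p w (vertex_mem_simplex p k)
        have h1 := contrWord_eq_vertex hp (vertex_mem_simplex p k)
          (eq_of_contr_eq_contr hp hab hv hw h)
        have h2 := contrWord_eq_vertex hp (vertex_mem_simplex p k)
          (eq_of_contr_eq_contr hp (Ne.symm hab) hw hv h.symm)
        exact absurd (hp.injective (h2.2.symm.trans h1.2)) hab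

/-! ### Functions on V_* as compatible families. -/

/-- A family indexed by words and vertices that respects the two basic identifications
`ψ_{wi}(p_i) = ψ_w(p_i)` and `ψ_{wi}(p_j) = ψ_{wj}(p_i)`. -/
structure Compatible {X : Type*} (G : List (Fin (N + 1)) → Fin (N + 1) → X) : Prop where
  self : ∀ w i, G (w ++ [i]) i = G w i
  comm : ∀ w i j, G (w ++ [i]) j = G (w ++ [j]) i

theorem Compatible.append_replicate {X : Type*} {G : List (Fin (N + 1)) → Fin (N + 1) → X}
    (hG : Compatible G) (w : List (Fin (N + 1))) (i : Fin (N + 1)) (n : ℕ) :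
    G (w ++ List.replicate n i) i = G w i := by
  induction n with
  | zero => simp
  | succ n ih => rw [List.replicate_succ', ← List.append_assoc, hG.self, ih]

/-- After the common prefix is removed, the words start with letters a ≠ b and must be a b⋯b with
corner b and b a⋯a with corner a. The rule `self` reduces both to words of length one, and `comm`
exchanges them. -/
theorem Compatible.eq_of_length_eq {p : Fin (N + 1) → EuclideanSpace ℝ (Fin N)}
    (hp : AffineIndependent ℝ p) {X : Type*} {G : List (Fin (N + 1)) → Fin (N + 1) → X}
    (hG : Compatible G) {v w : List (Fin (N + 1))} (hl : v.length = w.length)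
    {i j : Fin (N + 1)} (h : contrWord p v (p i) = contrWord p w (p j)) : G v i = G w j := by
  induction v generalizing w G with
  | nil =>
    obtain rfl := List.length_eq_zero_iff.1 hl.symm
    rw [hp.injective h]
  | cons a v ih =>
    cases w with
    | nil => simp at hl
    | cons b w =>
      by_cases hab : a = b
      · subst hab
        exact ih (G := fun w => G (a :: w)) ⟨fun w i => hG.self (a :: w) i,
          fun w i j => hG.comm (a :: w) i j⟩ (by simpa using hl) (contr_injective p a h)
      · have hv := contrWord_mem_simplex p v (vertex_mem_simplex p i)
        have hw := contrWord_mem_simplex p w (vertex_mem_simplex p j)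
        obtain ⟨h1, h1'⟩ := contrWord_eq_vertex hp (vertex_mem_simplex p i)
          (eq_of_contr_eq_contr hp hab hv hw h)
        obtain ⟨h2, h2'⟩ := contrWord_eq_vertex hp (vertex_mem_simplex p j)
          (eq_of_contr_eq_contr hp (Ne.symm hab) hw hv h.symm)
        obtain rfl := hp.injective h1'
        obtain rfl := hp.injective h2'
        rw [h1, h2]
        have e1 := hG.append_replicate [j] i v.length
        have e2 := hG.append_replicate [i] j w.length
        have e3 := hG.comm [] j i
        simp only [List.nil_append, List.cons_append] at e1 e2 e3
        rw [e1, e2, e3]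

/-- A compatible family is a function on `V_*`. -/
theorem Compatible.eq {p : Fin (N + 1) → EuclideanSpace ℝ (Fin N)}
    (hp : AffineIndependent ℝ p) {X : Type*} {G : List (Fin (N + 1)) → Fin (N + 1) → X}
    (hG : Compatible G) {v w : List (Fin (N + 1))} {i j : Fin (N + 1)}
    (h : contrWord p v (p i) = contrWord p w (p j)) : G v i = G w j := by
  rw [← hG.append_replicate v i w.length, ← hG.append_replicate w j v.length]
  refine hG.eq_of_length_eq hp (by simp [add_comm]) ?_
  rw [contrWord_append, contrWord_append, contrWord_replicate, contrWord_replicate, h]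

theorem vertex_concat_self (p : Fin (N + 1) → EuclideanSpace ℝ (Fin N))
    (w : List (Fin (N + 1))) (i : Fin (N + 1)) : vertex p (w ++ [i]) i = vertex p w i :=
  Subtype.ext (by simp [vertex, contrWord_append, contrWord, contr_self])

theorem vertex_concat_comm (p : Fin (N + 1) → EuclideanSpace ℝ (Fin N))
    (w : List (Fin (N + 1))) (i j : Fin (N + 1)) :
    vertex p (w ++ [i]) j = vertex p (w ++ [j]) i :=
  Subtype.ext (by simp [vertex, contrWord_append, contrWord, contr_comm p i j])

theorem exists_vertex {p : Fin (N + 1) → EuclideanSpace ℝ (Fin N)} (x : vertsStar p) :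
    ∃ w i, x = vertex p w i := by
  obtain ⟨x, hx⟩ := x
  obtain ⟨m, hm⟩ := Set.mem_iUnion.1 hx
  obtain ⟨w, -, -, ⟨i, rfl⟩, rfl⟩ := Set.mem_iUnion₂.1 hm
  exact ⟨w, i, rfl⟩

/-! ### Compactness and self-similarity of K. -/

theorem contr_continuous (p : Fin (N + 1) → EuclideanSpace ℝ (Fin N)) (i : Fin (N + 1)) :
    Continuous (contr p i) := by
  unfold contr; fun_prop

theorem contrWord_continuous (p : Fin (N + 1) → EuclideanSpace ℝ (Fin N))
    (w : List (Fin (N + 1))) : Continuous (contrWord p w) := by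
  induction w with
  | nil => exact continuous_id
  | cons i w ih => exact (contr_continuous p i).comp ih

theorem isCompact_simplex (p : Fin (N + 1) → EuclideanSpace ℝ (Fin N)) :
    IsCompact (simplex p) := (Set.finite_range p).isCompact_convexHull ℝ

theorem finite_words (m : ℕ) : {w : List (Fin (N + 1)) | w.length = m}.Finite :=
  List.finite_length_eq _ m

theorem gasket_subset_simplex (p : Fin (N + 1) → EuclideanSpace ℝ (Fin N)) :
    gasket p ⊆ simplex p := by
  intro x hx
  obtain ⟨w, -, y, hy, rfl⟩ := Set.mem_iUnion₂.1 (Set.mem_iInter.1 hx 0)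
  exact contrWord_mem_simplex p w hy

theorem isCompact_gasket (p : Fin (N + 1) → EuclideanSpace ℝ (Fin N)) :
    IsCompact (gasket p) := by
  refine (isCompact_simplex p).of_isClosed_subset ?_ (gasket_subset_simplex p)
  refine isClosed_iInter fun m => (finite_words m).isClosed_biUnion fun w _ => ?_
  exact ((isCompact_simplex p).image (contrWord_continuous p w)).isClosed

instance (p : Fin (N + 1) → EuclideanSpace ℝ (Fin N)) : CompactSpace (gasket p) :=
  isCompact_iff_compactSpace.1 (isCompact_gasket p)

theorem mem_image_simplex_of_length_le {p : Fin (N + 1) → EuclideanSpace ℝ (Fin N)}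
    {x : EuclideanSpace ℝ (Fin N)} {w : List (Fin (N + 1))} (n : ℕ)
    (hx : x ∈ contrWord p w '' simplex p) : x ∈ contrWord p (w.take n) '' simplex p := by
  obtain ⟨y, hy, rfl⟩ := hx
  refine ⟨contrWord p (w.drop n) y, contrWord_mem_simplex p _ hy, ?_⟩
  rw [← contrWord_append, List.take_append_drop]

/-- Pigeonhole: among the cells containing x, one at each positive level, infinitely many start with
the same letter i. Since ψ_i is injective, the same preimage of x lies in cells of arbitrarily high
level, hence in K. -/
theorem exists_contr_mem_gasket {p : Fin (N + 1) → EuclideanSpace ℝ (Fin N)}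
    {x : EuclideanSpace ℝ (Fin N)} (hx : x ∈ gasket p) :
    ∃ i, ∃ y ∈ gasket p, contr p i y = x := by
  have h : ∀ m : ℕ, ∃ i, ∃ w : List (Fin (N + 1)), w.length = m ∧
      x ∈ contrWord p (i :: w) '' simplex p := by
    intro m
    obtain ⟨w, hw, hxw⟩ := Set.mem_iUnion₂.1 (Set.mem_iInter.1 hx (m + 1))
    cases w with
    | nil => simp at hw
    | cons i w => exact ⟨i, w, by simpa using hw, hxw⟩
  choose a w hw hxw using h
  obtain ⟨i, hi⟩ := Finite.exists_infinite_fiber a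
  have hinf : (a ⁻¹' {i}).Infinite := Set.infinite_coe_iff.1 hi
  obtain ⟨m₀, hm₀⟩ := hinf.nonempty
  obtain ⟨z, -, hz⟩ := hxw m₀
  refine ⟨i, contrWord p (w m₀) z, Set.mem_iInter.2 fun m => ?_, ?_⟩
  · obtain ⟨n, hn, hmn⟩ := hinf.exists_gt m
    obtain ⟨z', hz', hz''⟩ := hxw n
    refine Set.mem_iUnion₂.2 ⟨(w n).take m, by simp [hw n, hmn.le], ?_⟩
    refine mem_image_simplex_of_length_le m ⟨z', hz', contr_injective p i ?_⟩
    have e1 : a m₀ = i := hm₀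
    have e2 : a n = i := hn
    rw [e1] at hz
    rw [e2] at hz''
    exact hz''.trans hz.symm
  · rw [← hz, show a m₀ = i from hm₀]; rfl

theorem contr_mem_gasket {p : Fin (N + 1) → EuclideanSpace ℝ (Fin N)} (i : Fin (N + 1))
    {x : EuclideanSpace ℝ (Fin N)} (hx : x ∈ gasket p) : contr p i x ∈ gasket p := by
  refine Set.mem_iInter.2 fun m => ?_
  obtain ⟨w, hw, hxw⟩ := Set.mem_iUnion₂.1 (Set.mem_iInter.1 hx m)
  obtain ⟨y, hy, rfl⟩ := hxw
  refine Set.mem_iUnion₂.2 ⟨(i :: w).take m, by simp at hw; simp [hw], ?_⟩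
  exact mem_image_simplex_of_length_le m ⟨y, hy, rfl⟩

theorem contrWord_gasket {p : Fin (N + 1) → EuclideanSpace ℝ (Fin N)} (w : List (Fin (N + 1)))
    {x : EuclideanSpace ℝ (Fin N)} (hx : x ∈ gasket p) : contrWord p w x ∈ gasket p := by
  induction w with
  | nil => exact hx
  | cons i w ih => exact contr_mem_gasket i ih

theorem exists_contrWord_mem_gasket {p : Fin (N + 1) → EuclideanSpace ℝ (Fin N)} (m : ℕ)
    {x : EuclideanSpace ℝ (Fin N)} (hx : x ∈ gasket p) :
    ∃ w : List (Fin (N + 1)), w.length = m ∧ ∃ y ∈ gasket p, contrWord p w y = x := by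
  induction m generalizing x with
  | zero => exact ⟨[], rfl, x, hx, rfl⟩
  | succ m ih =>
    obtain ⟨i, y, hy, rfl⟩ := exists_contr_mem_gasket hx
    obtain ⟨w, hw, z, hz, rfl⟩ := ih hy
    exact ⟨i :: w, by simp [hw], z, hz, rfl⟩

theorem exists_mem_cell {p : Fin (N + 1) → EuclideanSpace ℝ (Fin N)} (m : ℕ) (x : gasket p) :
    ∃ w : List (Fin (N + 1)), w.length = m ∧ x ∈ cell p w :=
  exists_contrWord_mem_gasket m x.2

theorem exists_mem_cell_append {p : Fin (N + 1) → EuclideanSpace ℝ (Fin N)}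
    {w : List (Fin (N + 1))} {x : gasket p} (hx : x ∈ cell p w) (m : ℕ) :
    ∃ v : List (Fin (N + 1)), v.length = m ∧ x ∈ cell p (w ++ v) := by
  obtain ⟨y, hy, hyx⟩ := hx
  obtain ⟨v, hv, z, hz, rfl⟩ := exists_contrWord_mem_gasket m hy
  exact ⟨v, hv, z, hz, by rw [contrWord_append, hyx]⟩

theorem cell_append_subset (p : Fin (N + 1) → EuclideanSpace ℝ (Fin N))
    (v w : List (Fin (N + 1))) : cell p (v ++ w) ⊆ cell p v := by
  rintro x ⟨y, hy, hyx⟩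
  exact ⟨contrWord p w y, contrWord_gasket w hy, by rw [← hyx, contrWord_append]⟩

theorem isClosed_cell (p : Fin (N + 1) → EuclideanSpace ℝ (Fin N)) (w : List (Fin (N + 1))) :
    IsClosed (cell p w) :=
  ((isCompact_gasket p).image (contrWord_continuous p w)).isClosed.preimage continuous_subtype_val

/-- The point `ψ_w(p_i)` of `K`. -/
def pt (p : Fin (N + 1) → EuclideanSpace ℝ (Fin N)) (w : List (Fin (N + 1))) (i : Fin (N + 1)) :
    gasket p := ⟨contrWord p w (p i), contrWord_mem_gasket p w i⟩

theorem restrictStar_vertex (p : Fin (N + 1) → EuclideanSpace ℝ (Fin N)) (f : C(gasket p, ℝ))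
    (w : List (Fin (N + 1))) (i : Fin (N + 1)) :
    restrictStar p f (vertex p w i) = f (pt p w i) := rfl

theorem pt_mem_cell (p : Fin (N + 1) → EuclideanSpace ℝ (Fin N)) (w : List (Fin (N + 1)))
    (i : Fin (N + 1)) : pt p w i ∈ cell p w :=
  ⟨p i, contrWord_mem_gasket p [] i, rfl⟩

/-- Distinct cells of the same level meet only at common vertices. -/
theorem exists_pt_eq_of_mem_cell {p : Fin (N + 1) → EuclideanSpace ℝ (Fin N)}
    (hp : AffineIndependent ℝ p) {v w : List (Fin (N + 1))} (hl : v.length = w.length)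
    (hvw : v ≠ w) {x : gasket p} (hv : x ∈ cell p v) (hw : x ∈ cell p w) :
    ∃ i, x = pt p v i := by
  obtain ⟨y, hy, hyx⟩ := hv
  obtain ⟨z, hz, hzx⟩ := hw
  obtain ⟨i, rfl⟩ := eq_vertex_of_contrWord_eq hp (fun h => hvw (h.eq_of_length hl))
    (fun h => hvw (h.eq_of_length hl.symm).symm) (gasket_subset_simplex p hy)
    (gasket_subset_simplex p hz) (hyx.trans hzx.symm)
  exact ⟨i, Subtype.ext hyx.symm⟩

theorem dist_contrWord (p : Fin (N + 1) → EuclideanSpace ℝ (Fin N)) (w : List (Fin (N + 1)))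
    (x y : EuclideanSpace ℝ (Fin N)) :
    dist (contrWord p w x) (contrWord p w y) = (2 : ℝ)⁻¹ ^ w.length * dist x y := by
  induction w with
  | nil => simp [contrWord]
  | cons i w ih =>
    rw [contrWord, contrWord, contr, contr, dist_smul₀, dist_add_right, ih, List.length_cons,
      pow_succ]
    norm_num
    ring

theorem dist_le_of_mem_cell {p : Fin (N + 1) → EuclideanSpace ℝ (Fin N)}
    {w : List (Fin (N + 1))} {x y : gasket p} (hx : x ∈ cell p w) (hy : y ∈ cell p w) :
    dist x y ≤ (2 : ℝ)⁻¹ ^ w.length * Metric.diam (gasket p) := by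
  obtain ⟨x', hx', hx⟩ := hx
  obtain ⟨y', hy', hy⟩ := hy
  rw [Subtype.dist_eq, ← hx, ← hy, dist_contrWord]
  exact mul_le_mul_of_nonneg_left (Metric.dist_le_diam_of_mem (isCompact_gasket p).isBounded hx' hy')
    (by positivity)

/-- A closed condition holding at the vertices of the subcells of `K_w` holds on `K_w`. -/
theorem forall_mem_cell_of_forall_pt {p : Fin (N + 1) → EuclideanSpace ℝ (Fin N)}
    {s : Set (gasket p)} (hs : IsClosed s) {w : List (Fin (N + 1))}
    (h : ∀ v, pt p (w ++ v) 0 ∈ s) {x : gasket p} (hx : x ∈ cell p w) : x ∈ s := by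
  choose v hv hxv using exists_mem_cell_append hx
  refine hs.mem_of_tendsto (f := fun m => pt p (w ++ v m) 0) (b := atTop) ?_
    (Eventually.of_forall fun m => h _)
  rw [tendsto_iff_dist_tendsto_zero]
  have h0 : Tendsto (fun m : ℕ => (2 : ℝ)⁻¹ ^ m * Metric.diam (gasket p)) atTop (𝓝 0) := by
    simpa using (tendsto_pow_atTop_nhds_zero_of_lt_one (r := (2 : ℝ)⁻¹) (by norm_num)
      (by norm_num)).mul_const (Metric.diam (gasket p))
  refine squeeze_zero (fun _ => dist_nonneg) (fun m => ?_) h0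
  refine (dist_le_of_mem_cell (pt_mem_cell p _ 0) (hxv m)).trans ?_
  refine mul_le_mul_of_nonneg_right ?_ Metric.diam_nonneg
  refine pow_le_pow_of_le_one (by norm_num) (by norm_num) ?_
  rw [List.length_append, hv]
  exact Nat.le_add_left _ _

theorem forall_of_forall_pt {p : Fin (N + 1) → EuclideanSpace ℝ (Fin N)}
    {s : Set (gasket p)} (hs : IsClosed s) (h : ∀ v, pt p v 0 ∈ s) (x : gasket p) : x ∈ s :=
  forall_mem_cell_of_forall_pt (w := []) hs h ⟨x, x.2, rfl⟩

/-! ### Continuous extension from V_* to K, and piecewise harmonic splines. -/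

/-- Two cells of level at least `m` that share a point carry close values. -/
theorem Compatible.abs_sub_le {p : Fin (N + 1) → EuclideanSpace ℝ (Fin N)}
    (hp : AffineIndependent ℝ p) {G : List (Fin (N + 1)) → Fin (N + 1) → ℝ} (hG : Compatible G)
    {ε : ℝ} {m : ℕ} (hm : ∀ w, w.length = m → ∀ v i j, |G (w ++ v) i - G w j| ≤ ε)
    {v w : List (Fin (N + 1))} (hv : m ≤ v.length) (hw : m ≤ w.length) {x : gasket p}
    (hxv : x ∈ cell p v) (hxw : x ∈ cell p w) (i j : Fin (N + 1)) :
    |G v i - G w j| ≤ 2 * ε := by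
  have hv' : (v.take m).length = m := by simp [hv]
  have hw' : (w.take m).length = m := by simp [hw]
  have hGv := hm _ hv' (v.drop m)
  have hGw := hm _ hw' (w.drop m)
  have hxv' := cell_append_subset p (v.take m) (v.drop m) (by rwa [List.take_append_drop])
  have hxw' := cell_append_subset p (w.take m) (w.drop m) (by rwa [List.take_append_drop])
  rw [List.take_append_drop] at hGv hGw
  have key : ∃ a b, G (v.take m) a = G (w.take m) b := by
    by_cases hvw : v.take m = w.take m
    · exact ⟨0, 0, by rw [hvw]⟩
    · obtain ⟨a, ha⟩ := exists_pt_eq_of_mem_cell hp (hv'.trans hw'.symm) hvw hxv' hxw'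
      obtain ⟨b, hb⟩ := exists_pt_eq_of_mem_cell hp (hw'.trans hv'.symm) (Ne.symm hvw) hxw' hxv'
      exact ⟨a, b, hG.eq hp (congrArg Subtype.val (ha.symm.trans hb))⟩
  obtain ⟨a, b, hab⟩ := key
  have h1 := abs_le.1 (hGv i a)
  have h2 := abs_le.1 (hGw j b)
  rw [hab] at h1
  rw [abs_le]
  constructor <;> linarith [h1.1, h1.2, h2.1, h2.2]

/-- A compatible family with vanishing oscillation extends to a continuous function on `K`. -/
theorem Compatible.exists_continuous {p : Fin (N + 1) → EuclideanSpace ℝ (Fin N)}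
    (hp : AffineIndependent ℝ p) {G : List (Fin (N + 1)) → Fin (N + 1) → ℝ} (hG : Compatible G)
    (hosc : ∀ ε > 0, ∃ m, ∀ w, w.length = m → ∀ v i j, |G (w ++ v) i - G w j| ≤ ε) :
    ∃ f : C(gasket p, ℝ), ∀ w i, f (pt p w i) = G w i := by
  -- An arbitrary cell of each level around x; where cells overlap, `Compatible.abs_sub_le` makes
  -- the choice immaterial in the limit.
  choose W hW hxW using fun (m : ℕ) (x : gasket p) => exists_mem_cell m x
  have hcau : ∀ x, ∃ L, Tendsto (fun m => G (W m x) 0) atTop (𝓝 L) := by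
    intro x
    refine cauchySeq_tendsto_of_complete (Metric.cauchySeq_iff'.2 fun ε hε => ?_)
    obtain ⟨m, hm⟩ := hosc (ε / 4) (by positivity)
    refine ⟨m, fun n hn => ?_⟩
    rw [Real.dist_eq]
    have := hG.abs_sub_le hp hm (hn.trans_eq (hW n x).symm) (hW m x).ge (hxW n x) (hxW m x) 0 0
    linarith
  choose F hF using hcau
  have happrox : ∀ {ε : ℝ} {m : ℕ}, (∀ w, w.length = m → ∀ v i j, |G (w ++ v) i - G w j| ≤ ε) →
      ∀ {w : List (Fin (N + 1))} {x : gasket p}, m ≤ w.length → x ∈ cell p w → ∀ i,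
        |F x - G w i| ≤ 2 * ε := by
    intro ε m hm w x hw hx i
    refine le_of_tendsto ((hF x).sub_const (G w i)).abs ?_
    filter_upwards [eventually_ge_atTop m] with n hn
    exact hG.abs_sub_le hp hm (hn.trans_eq (hW n x).symm) hw (hxW n x) hx 0 i
  refine ⟨⟨F, continuous_iff_continuousAt.2 fun x => ?_⟩, fun w i => ?_⟩
  · rw [Metric.continuousAt_iff']
    intro ε hε
    obtain ⟨m, hm⟩ := hosc (ε / 8) (by positivity)
    -- Finitely many cells of level m miss x, so their union is closed. Any y outside it lies only
    -- in level m cells that also contain x.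
    have hcl : IsClosed (⋃ w ∈ {w : List (Fin (N + 1)) | w.length = m ∧ x ∉ cell p w},
        cell p w) :=
      ((finite_words m).subset fun w hw => hw.1).isClosed_biUnion fun w _ => isClosed_cell p w
    have hx : x ∈ (⋃ w ∈ {w : List (Fin (N + 1)) | w.length = m ∧ x ∉ cell p w},
        cell p w)ᶜ := by
      intro h
      obtain ⟨w, hw, hxw⟩ := Set.mem_iUnion₂.1 h
      exact hw.2 hxw
    filter_upwards [hcl.isOpen_compl.mem_nhds hx] with y hy
    have hxy : x ∈ cell p (W m y) := by
      by_contra hxy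
      exact hy (Set.mem_iUnion₂.2 ⟨W m y, ⟨hW m y, hxy⟩, hxW m y⟩)
    have h1 := abs_le.1 (happrox hm (hW m y).ge hxy 0)
    have h2 := abs_le.1 (happrox hm (hW m y).ge (hxW m y) 0)
    rw [Real.dist_eq, abs_lt]
    constructor <;> linarith [h1.1, h1.2, h2.1, h2.2]
  · change F (pt p w i) = G w i
    refine eq_of_forall_dist_le fun ε hε => ?_
    obtain ⟨m, hm⟩ := hosc (ε / 2) (by positivity)
    -- Padding the word by i^m keeps the point and raises the level to at least m.
    have hx : pt p w i = pt p (w ++ List.replicate m i) i :=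
      Subtype.ext (by simp [pt, contrWord_append, contrWord_replicate])
    have h := happrox hm (w := w ++ List.replicate m i) (by simp)
      (hx ▸ pt_mem_cell p (w ++ List.replicate m i) i) i
    rw [hG.append_replicate] at h
    rw [Real.dist_eq]
    linarith

/-- The vertex values of the function that is equal to `φ` on `V_n` and harmonic in every cell of
level `n`. -/
def splineVals (p : Fin (N + 1) → EuclideanSpace ℝ (Fin N)) (φ : vertsStar p → ℝ) (n : ℕ)
    (w : List (Fin (N + 1))) : Fin (N + 1) → ℝ :=
  wordVals (w.drop n) fun k => φ (vertex p (w.take n) k)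

theorem splineVals_of_length_le (p : Fin (N + 1) → EuclideanSpace ℝ (Fin N))
    (φ : vertsStar p → ℝ) {n : ℕ} {w : List (Fin (N + 1))} (hw : w.length ≤ n)
    (i : Fin (N + 1)) : splineVals p φ n w i = φ (vertex p w i) := by
  rw [splineVals, List.drop_eq_nil_of_le hw, List.take_of_length_le hw]; rfl

theorem splineVals_append (p : Fin (N + 1) → EuclideanSpace ℝ (Fin N))
    (φ : vertsStar p → ℝ) {n : ℕ} {w : List (Fin (N + 1))} (hw : n ≤ w.length)
    (v : List (Fin (N + 1))) : splineVals p φ n (w ++ v) = wordVals v (splineVals p φ n w) := by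
  rw [splineVals, splineVals, List.drop_append_of_le_length hw, List.take_append_of_le_length hw,
    wordVals_append]

theorem compatible_splineVals (p : Fin (N + 1) → EuclideanSpace ℝ (Fin N))
    (φ : vertsStar p → ℝ) (n : ℕ) : Compatible (splineVals p φ n) where
  self w i := by
    rcases lt_or_ge w.length n with h | h
    · rw [splineVals_of_length_le p φ (by simpa using h), splineVals_of_length_le p φ h.le,
        vertex_concat_self]
    · rw [splineVals_append p φ h]
      exact cellVals_self i _
  comm w i j := by
    rcases lt_or_ge w.length n with h | h
    · rw [splineVals_of_length_le p φ (by simpa using h),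
        splineVals_of_length_le p φ (by simpa using h), vertex_concat_comm]
    · rw [splineVals_append p φ h, splineVals_append p φ h]
      exact cellVals_comm i j _

/-- The finitely many cells of level n have a common oscillation bound. Below that level it shrinks
by `(scale N)⁻¹` per step, and the maximum principle controls all subcells at once. -/
theorem exists_splineVals_osc_le (p : Fin (N + 1) → EuclideanSpace ℝ (Fin N))
    (φ : vertsStar p → ℝ) (n : ℕ) {ε : ℝ} (hε : 0 < ε) :
    ∃ m, ∀ w, w.length = m → ∀ v i j,
      |splineVals p φ n (w ++ v) i - splineVals p φ n w j| ≤ ε := by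
  obtain ⟨M, hM⟩ : ∃ M, ∀ w : List (Fin (N + 1)), w.length = n → ∀ j k,
      |φ (vertex p w j) - φ (vertex p w k)| ≤ M := by
    obtain ⟨M, hM⟩ := (((finite_words n).prod (Set.finite_univ (α := Fin (N + 1) × Fin (N + 1)))).image
      fun z => |φ (vertex p z.1 z.2.1) - φ (vertex p z.1 z.2.2)|).bddAbove
    exact ⟨M, fun w hw j k => hM ⟨(w, j, k), ⟨hw, trivial⟩, rfl⟩⟩
  have h0 : Tendsto (fun k : ℕ => (scale N)⁻¹ ^ k * M) atTop (𝓝 0) := by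
    simpa using (tendsto_pow_atTop_nhds_zero_of_lt_one (inv_nonneg.2 scale_pos.le)
      inv_scale_lt_one).mul_const M
  obtain ⟨k, hk⟩ := (h0.eventually (ge_mem_nhds hε)).exists
  refine ⟨n + k, fun w hw v i j => ?_⟩
  have hosc : ∀ a b, |splineVals p φ n w a - splineVals p φ n w b| ≤ ε := by
    intro a b
    refine le_trans ?_ hk
    have h := abs_wordVals_sub_le (w.drop n) (hM (w.take n) (by simp [hw])) a b
    rwa [List.length_drop, hw, Nat.add_sub_cancel_left] at h
  rw [splineVals_append p φ (by omega), abs_sub_le_iff]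
  have h := wordVals_mem_Icc (a := splineVals p φ n w j - ε) (b := splineVals p φ n w j + ε) v
    (u := splineVals p φ n w)
    (fun a => by
      have := abs_le.1 (hosc a j)
      exact ⟨by linarith [this.1], by linarith [this.2]⟩) i
  exact ⟨by linarith [h.2], by linarith [h.1]⟩

theorem exists_spline {p : Fin (N + 1) → EuclideanSpace ℝ (Fin N)}
    (hp : AffineIndependent ℝ p) (φ : vertsStar p → ℝ) (n : ℕ) :
    ∃ f : C(gasket p, ℝ), ∀ w i, f (pt p w i) = splineVals p φ n w i :=
  (compatible_splineVals p φ n).exists_continuous hp fun _ hε => exists_splineVals_osc_le p φ n hε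

/-- `g` is harmonic in every cell of level `n`. -/
def HarmonicFrom (p : Fin (N + 1) → EuclideanSpace ℝ (Fin N)) (n : ℕ) (g : vertsStar p → ℝ) :
    Prop :=
  ∀ w : List (Fin (N + 1)), n ≤ w.length → ∀ i,
    (fun j => g (vertex p (w ++ [i]) j)) = cellVals i fun k => g (vertex p w k)

theorem harmonicFrom_of_splineVals {p : Fin (N + 1) → EuclideanSpace ℝ (Fin N)}
    {φ : vertsStar p → ℝ} {n : ℕ} {f : C(gasket p, ℝ)}
    (hf : ∀ w i, f (pt p w i) = splineVals p φ n w i) :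
    HarmonicFrom p n (restrictStar p f) := by
  intro w hw i
  simp only [restrictStar_vertex, hf, splineVals_append p φ hw]
  rfl

theorem HarmonicFrom.wordVals {p : Fin (N + 1) → EuclideanSpace ℝ (Fin N)} {n : ℕ}
    {g : vertsStar p → ℝ} (hg : HarmonicFrom p n g) {w : List (Fin (N + 1))} (hw : n ≤ w.length)
    (v : List (Fin (N + 1))) :
    (fun j => g (vertex p (w ++ v) j)) = wordVals v fun k => g (vertex p w k) := by
  induction v generalizing w with
  | nil => simp [SierpinskiGasket.wordVals]
  | cons i v ih =>
    have h := ih (w := w ++ [i]) (by simp; omega)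
    rw [hg w hw i] at h
    rw [SierpinskiGasket.wordVals, ← h]
    simp

/-! ### Level energies and their limit. -/

/-- The sum of `F` over the words of length `m`. -/
def wordSum (m : ℕ) (F : List (Fin (N + 1)) → ℝ) : ℝ :=
  ∑ w : Fin m → Fin (N + 1), F (List.ofFn w)

theorem wordSum_zero (F : List (Fin (N + 1)) → ℝ) : wordSum 0 F = F [] := by
  simp [wordSum]

theorem wordSum_succ (m : ℕ) (F : List (Fin (N + 1)) → ℝ) :
    wordSum (m + 1) F = wordSum m fun w => ∑ i, F (w ++ [i]) := by
  rw [wordSum, wordSum, Finset.sum_comm, ← Fintype.sum_prod_type']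
  refine (Fintype.sum_equiv (Fin.snocEquiv fun _ => Fin (N + 1)) _ _ fun x => ?_).symm
  change _ = F (List.ofFn (Fin.snoc (α := fun _ => Fin (N + 1)) x.2 x.1))
  rw [List.ofFn_succ']
  simp [List.concat_eq_append]

theorem wordSum_add (m k : ℕ) (F : List (Fin (N + 1)) → ℝ) :
    wordSum (m + k) F = wordSum m fun w => wordSum k fun v => F (w ++ v) := by
  induction k generalizing F with
  | zero => simp [wordSum_zero]
  | succ k ih =>
    rw [← add_assoc, wordSum_succ, ih]
    simp only [wordSum_succ, List.append_assoc]

theorem wordSum_congr {m : ℕ} {F G : List (Fin (N + 1)) → ℝ}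
    (h : ∀ w : List (Fin (N + 1)), w.length = m → F w = G w) : wordSum m F = wordSum m G :=
  Finset.sum_congr rfl fun _ _ => h _ (List.length_ofFn)

theorem wordSum_le {m : ℕ} {F G : List (Fin (N + 1)) → ℝ}
    (h : ∀ w : List (Fin (N + 1)), w.length = m → F w ≤ G w) : wordSum m F ≤ wordSum m G :=
  Finset.sum_le_sum fun _ _ => h _ (List.length_ofFn)

theorem wordSum_nonneg {m : ℕ} {F : List (Fin (N + 1)) → ℝ}
    (h : ∀ w : List (Fin (N + 1)), w.length = m → 0 ≤ F w) : 0 ≤ wordSum m F :=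
  Finset.sum_nonneg fun _ _ => h _ (List.length_ofFn)

theorem wordSum_add_distrib (m : ℕ) (F G : List (Fin (N + 1)) → ℝ) :
    wordSum m (fun w => F w + G w) = wordSum m F + wordSum m G := Finset.sum_add_distrib

theorem wordSum_mul_left (m : ℕ) (c : ℝ) (F : List (Fin (N + 1)) → ℝ) :
    wordSum m (fun w => c * F w) = c * wordSum m F := (Finset.mul_sum _ _ _).symm

/-- The values of `f` at the vertices of the cell `w`. -/
def vals (p : Fin (N + 1) → EuclideanSpace ℝ (Fin N)) (f : vertsStar p → ℝ)
    (w : List (Fin (N + 1))) : Fin (N + 1) → ℝ := fun k => f (vertex p w k)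

/-- The renormalized form of level `m`. -/
def energyLevel (p : Fin (N + 1) → EuclideanSpace ℝ (Fin N)) (m : ℕ) (f g : vertsStar p → ℝ) : ℝ :=
  scale N ^ m * wordSum m fun w => formZero (vals p f w) (vals p g w)

theorem energyStar_eq_iSup (p : Fin (N + 1) → EuclideanSpace ℝ (Fin N)) (f : vertsStar p → ℝ) :
    energyStar p f = ⨆ m : ℕ, ENNReal.ofReal (energyLevel p m f f) := rfl

variable {p : Fin (N + 1) → EuclideanSpace ℝ (Fin N)}

theorem HarmonicFrom.vals_concat {n : ℕ} {g : vertsStar p → ℝ} (hg : HarmonicFrom p n g)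
    {w : List (Fin (N + 1))} (hw : n ≤ w.length) (i : Fin (N + 1)) :
    vals p g (w ++ [i]) = cellVals i (vals p g w) := hg w hw i

theorem energyLevel_comm (m : ℕ) (f g : vertsStar p → ℝ) :
    energyLevel p m f g = energyLevel p m g f := by
  simp only [energyLevel, formZero_comm]

theorem energyLevel_nonneg (m : ℕ) (f : vertsStar p → ℝ) : 0 ≤ energyLevel p m f f :=
  mul_nonneg (pow_nonneg scale_pos.le _) (wordSum_nonneg fun _ _ => formZero_nonneg _)

/-- Sums `scale_mul_sum_formZero` over cells: the increment measures the failure of f to be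
harmonic. It yields both monotonicity and the description of minimizers. -/
theorem energyLevel_succ (m : ℕ) (f : vertsStar p → ℝ) :
    energyLevel p (m + 1) f f = energyLevel p m f f +
      scale N ^ (m + 1) * wordSum m fun w => ∑ i,
        formZero (vals p f (w ++ [i]) - cellVals i (vals p f w))
          (vals p f (w ++ [i]) - cellVals i (vals p f w)) := by
  rw [energyLevel, energyLevel, wordSum_succ, pow_succ, mul_assoc, mul_assoc, ← mul_add]
  congr 1
  rw [← wordSum_mul_left, ← wordSum_mul_left, ← wordSum_add_distrib]
  refine wordSum_congr fun w _ => ?_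
  refine scale_mul_sum_formZero (vals p f w) (fun i => vals p f (w ++ [i])) (fun i j => ?_)
    fun i => ?_
  · exact congrArg f (vertex_concat_comm p w i j)
  · exact congrArg f (vertex_concat_self p w i)

theorem energyLevel_mono (f : vertsStar p → ℝ) : Monotone fun m => energyLevel p m f f := by
  refine monotone_nat_of_le_succ fun m => ?_
  rw [energyLevel_succ]
  exact le_add_of_nonneg_right (mul_nonneg (pow_nonneg scale_pos.le _)
    (wordSum_nonneg fun w _ => Finset.sum_nonneg fun i _ => formZero_nonneg _))

/-- Green's identity in every cell. One piecewise harmonic argument suffices for the sequence to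
become stationary; f is arbitrary. -/
theorem HarmonicFrom.energyLevel_eq {n m : ℕ} {g : vertsStar p → ℝ} (hg : HarmonicFrom p n g)
    (hnm : n ≤ m) (f : vertsStar p → ℝ) : energyLevel p m g f = energyLevel p n g f := by
  induction m, hnm using Nat.le_induction with
  | base => rfl
  | succ m hm ih =>
    rw [← ih, energyLevel, energyLevel, wordSum_succ, pow_succ, mul_assoc, ← wordSum_mul_left]
    congr 1
    refine wordSum_congr fun w hw => ?_
    simp only [hg.vals_concat (hm.trans_eq hw.symm)]
    rw [sum_formZero_cellVals]
    · congr 1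
      exact funext fun i => congrArg f (vertex_concat_self p w i)
    · exact fun i j => congrArg f (vertex_concat_comm p w i j)

theorem energyStar_lt_top_of_le {f : vertsStar p → ℝ} {C : ℝ}
    (h : ∀ m, energyLevel p m f f ≤ C) : energyStar p f < ∞ := by
  rw [energyStar_eq_iSup]
  exact (iSup_le fun m => ENNReal.ofReal_le_ofReal (h m)).trans_lt ENNReal.ofReal_lt_top

theorem energyLevel_le {f : vertsStar p → ℝ} (hf : energyStar p f < ∞) (m : ℕ) :
    energyLevel p m f f ≤ (energyStar p f).toReal := by
  rw [← ENNReal.ofReal_le_iff_le_toReal hf.ne, energyStar_eq_iSup]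
  exact le_iSup (fun m => ENNReal.ofReal (energyLevel p m f f)) m

theorem tendsto_energyLevel_self {f : vertsStar p → ℝ} (hf : energyStar p f < ∞) :
    Tendsto (fun m => energyLevel p m f f) atTop (𝓝 (energyStar p f).toReal) := by
  have h : Tendsto (fun m => ENNReal.ofReal (energyLevel p m f f)) atTop (𝓝 (energyStar p f)) := by
    rw [energyStar_eq_iSup]
    exact tendsto_atTop_iSup fun a b hab => ENNReal.ofReal_le_ofReal (energyLevel_mono f hab)
  refine ((ENNReal.tendsto_toReal hf.ne).comp h).congr fun m => ?_
  exact ENNReal.toReal_ofReal (energyLevel_nonneg m f)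

theorem formZero_add_add (f g : Fin (N + 1) → ℝ) :
    formZero (f + g) (f + g) = formZero f f + 2 * formZero f g + formZero g g := by
  unfold formZero
  simp only [Finset.mul_sum, ← Finset.sum_add_distrib, Pi.add_apply]
  exact Finset.sum_congr rfl fun i _ => Finset.sum_congr rfl fun j _ => by ring

theorem formZero_add_le (f g : Fin (N + 1) → ℝ) :
    formZero (f + g) (f + g) ≤ 2 * formZero f f + 2 * formZero g g := by
  have h := formZero_nonneg (f - g)
  rw [formZero_sub_sub, formZero_comm g f] at h
  rw [formZero_add_add]
  linarith

theorem formZero_mul_le {A B : ℝ} {f g : Fin (N + 1) → ℝ} (hf : ∀ i, |f i| ≤ A)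
    (hg : ∀ i, |g i| ≤ B) :
    formZero (f * g) (f * g) ≤ 2 * B ^ 2 * formZero f f + 2 * A ^ 2 * formZero g g := by
  unfold formZero
  simp only [Finset.mul_sum, ← Finset.sum_add_distrib]
  refine Finset.sum_le_sum fun i _ => Finset.sum_le_sum fun j _ => ?_
  simp only [Pi.mul_apply]
  have h1 : f i ^ 2 ≤ A ^ 2 := sq_le_sq' (abs_le.1 (hf i)).1 (abs_le.1 (hf i)).2
  have h2 : g j ^ 2 ≤ B ^ 2 := sq_le_sq' (abs_le.1 (hg j)).1 (abs_le.1 (hg j)).2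
  have h3 := mul_le_mul_of_nonneg_right h1 (sq_nonneg (g i - g j))
  have h4 := mul_le_mul_of_nonneg_right h2 (sq_nonneg (f i - f j))
  have e : f i * g i - f j * g j = f i * (g i - g j) + g j * (f i - f j) := by ring
  rw [e]
  nlinarith [sq_nonneg (f i * (g i - g j) - g j * (f i - f j))]

theorem mem_domain_of_le {f : C(gasket p, ℝ)} {C : ℝ}
    (h : ∀ m, energyLevel p m (restrictStar p f) (restrictStar p f) ≤ C) : f ∈ domain p :=
  energyStar_lt_top_of_le h

theorem domain_add {f g : C(gasket p, ℝ)} (hf : f ∈ domain p) (hg : g ∈ domain p) :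
    f + g ∈ domain p := by
  refine mem_domain_of_le (C := 2 * (energyStar p (restrictStar p f)).toReal
    + 2 * (energyStar p (restrictStar p g)).toReal) fun m => ?_
  refine le_trans ?_ (add_le_add (mul_le_mul_of_nonneg_left (energyLevel_le hf m) zero_le_two)
    (mul_le_mul_of_nonneg_left (energyLevel_le hg m) zero_le_two))
  simp only [energyLevel]
  rw [mul_left_comm, mul_left_comm 2, ← mul_add]
  refine mul_le_mul_of_nonneg_left ?_ (pow_nonneg scale_pos.le _)
  rw [← wordSum_mul_left, ← wordSum_mul_left, ← wordSum_add_distrib]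
  exact wordSum_le fun w _ => formZero_add_le _ _

theorem domain_mul {f g : C(gasket p, ℝ)} (hf : f ∈ domain p) (hg : g ∈ domain p) :
    f * g ∈ domain p := by
  refine mem_domain_of_le (C := 2 * ‖g‖ ^ 2 * (energyStar p (restrictStar p f)).toReal
    + 2 * ‖f‖ ^ 2 * (energyStar p (restrictStar p g)).toReal) fun m => ?_
  refine le_trans ?_ (add_le_add
    (mul_le_mul_of_nonneg_left (energyLevel_le hf m) (by positivity))
    (mul_le_mul_of_nonneg_left (energyLevel_le hg m) (by positivity)))
  simp only [energyLevel]
  rw [mul_left_comm, mul_left_comm (2 * ‖f‖ ^ 2), ← mul_add]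
  refine mul_le_mul_of_nonneg_left ?_ (pow_nonneg scale_pos.le _)
  rw [← wordSum_mul_left, ← wordSum_mul_left, ← wordSum_add_distrib]
  refine wordSum_le fun w _ => ?_
  exact formZero_mul_le (fun i => f.norm_coe_le_norm _) (fun i => g.norm_coe_le_norm _)

theorem tendsto_energyLevel {f g : C(gasket p, ℝ)} (hf : f ∈ domain p) (hg : g ∈ domain p) :
    Tendsto (fun m => energyLevel p m (restrictStar p f) (restrictStar p g)) atTop
      (𝓝 (energy p f g)) := by
  have h := (((tendsto_energyLevel_self (domain_add hf hg)).sub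
    (tendsto_energyLevel_self hf)).sub (tendsto_energyLevel_self hg)).const_mul (1 / 2)
  refine h.congr fun m => ?_
  have e : energyLevel p m (restrictStar p (f + g)) (restrictStar p (f + g)) =
      energyLevel p m (restrictStar p f) (restrictStar p f)
        + 2 * energyLevel p m (restrictStar p f) (restrictStar p g)
        + energyLevel p m (restrictStar p g) (restrictStar p g) := by
    simp only [energyLevel]
    rw [mul_left_comm 2, ← mul_add, ← mul_add]
    congr 1
    rw [← wordSum_mul_left, ← wordSum_add_distrib, ← wordSum_add_distrib]
    exact wordSum_congr fun w _ => formZero_add_add _ _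
  rw [e]
  ring

/-! ### Energy minimizers are the harmonic extensions. -/

theorem energyLevel_zero (f g : vertsStar p → ℝ) :
    energyLevel p 0 f g = formZero (vals p f []) (vals p g []) := by
  simp [energyLevel, wordSum_zero]

theorem energy_self_eq {f : C(gasket p, ℝ)} (hf : f ∈ domain p) :
    energy p f f = (energyStar p (restrictStar p f)).toReal :=
  tendsto_nhds_unique (tendsto_energyLevel hf hf) (tendsto_energyLevel_self hf)

theorem HarmonicFrom.mem_domain {n : ℕ} {g : C(gasket p, ℝ)}
    (hg : HarmonicFrom p n (restrictStar p g)) : g ∈ domain p :=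
  mem_domain_of_le fun m => ((energyLevel_mono _ (le_max_left m n)).trans_eq
    (hg.energyLevel_eq (le_max_right m n) _))

theorem HarmonicFrom.energy_eq {n : ℕ} {g f : C(gasket p, ℝ)}
    (hg : HarmonicFrom p n (restrictStar p g)) (hf : f ∈ domain p) :
    energy p g f = energyLevel p n (restrictStar p g) (restrictStar p f) := by
  refine tendsto_nhds_unique (tendsto_energyLevel hg.mem_domain hf) ?_
  refine tendsto_const_nhds.congr' ?_
  filter_upwards [eventually_ge_atTop n] with m hm
  exact (hg.energyLevel_eq hm _).symm

theorem HarmonicFrom.isHarmonic {g : C(gasket p, ℝ)}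
    (hg : HarmonicFrom p 0 (restrictStar p g)) : IsHarmonic p g := by
  refine ⟨hg.mem_domain, fun f hf hfg => ?_⟩
  rw [hg.energy_eq hg.mem_domain, energy_self_eq hf, energyLevel_zero]
  have h : vals p (restrictStar p g) [] = vals p (restrictStar p f) [] :=
    funext fun i => (hfg i).symm
  rw [h, ← energyLevel_zero]
  exact energyLevel_le hf 0

theorem exists_harmonicFrom_zero (hp : AffineIndependent ℝ p) (u : Fin (N + 1) → ℝ) :
    ∃ f : C(gasket p, ℝ), HarmonicFrom p 0 (restrictStar p f) ∧ ∀ i, f (corner p i) = u i := by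
  obtain ⟨f, hf⟩ := exists_spline hp
    -- A spline of level 0 sees only V_0, so the default value 0 elsewhere plays no role.
    (fun x => if h : ∃ i, x = vertex p [] i then u h.choose else 0) 0
  refine ⟨f, harmonicFrom_of_splineVals hf, fun i => ?_⟩
  have h : ∃ j, vertex p [] i = vertex p [] j := ⟨i, rfl⟩
  change f (pt p [] i) = u i
  rw [hf, splineVals_of_length_le _ _ (by simp), dif_pos h]
  exact congrArg u (hp.injective (congrArg Subtype.val h.choose_spec)).symm

/-- Comparison with the harmonic extension of the same corner values shows that the energy of h is
already attained at level 0. All increments then vanish, so the deviation in each cell is constant;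
it is 0 at the corner shared with the parent cell. -/
theorem IsHarmonic.harmonicFrom (hp : AffineIndependent ℝ p) {h : C(gasket p, ℝ)}
    (hh : IsHarmonic p h) : HarmonicFrom p 0 (restrictStar p h) := by
  obtain ⟨f, hf, hfu⟩ := exists_harmonicFrom_zero hp fun i => h (corner p i)
  have hle := hh.2 f hf.mem_domain hfu
  rw [hf.energy_eq hf.mem_domain, energy_self_eq hh.1, energyLevel_zero,
    show vals p (restrictStar p f) [] = vals p (restrictStar p h) [] from funext hfu,
    ← energyLevel_zero] at hle
  have hconst : ∀ m, energyLevel p m (restrictStar p h) (restrictStar p h) =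
      energyLevel p 0 (restrictStar p h) (restrictStar p h) := fun m =>
    le_antisymm ((energyLevel_le hh.1 m).trans hle) (energyLevel_mono _ (Nat.zero_le m))
  intro w _ i
  have hs := energyLevel_succ w.length (restrictStar p h)
  rw [hconst (w.length + 1), hconst w.length] at hs
  have h0 : (wordSum w.length fun w => ∑ i,
      formZero (vals p (restrictStar p h) (w ++ [i]) - cellVals i (vals p (restrictStar p h) w))
        (vals p (restrictStar p h) (w ++ [i]) - cellVals i (vals p (restrictStar p h) w))) = 0 := by
    have hne : scale N ^ (w.length + 1) ≠ 0 := pow_ne_zero _ scale_pos.ne'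
    have := left_eq_add.1 hs
    exact (mul_eq_zero.1 this).resolve_left hne
  have h1 := (Finset.sum_eq_zero_iff_of_nonneg fun _ _ =>
    Finset.sum_nonneg fun _ _ => formZero_nonneg _).1 h0 w.get (Finset.mem_univ _)
  rw [List.ofFn_get] at h1
  have h2 := (Finset.sum_eq_zero_iff_of_nonneg fun _ _ => formZero_nonneg _).1 h1 i
    (Finset.mem_univ i)
  funext j
  have h3 := eq_of_formZero_eq_zero h2 j i
  simp only [Pi.sub_apply, cellVals_self] at h3
  have h4 : vals p (restrictStar p h) (w ++ [i]) i = vals p (restrictStar p h) w i :=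
    congrArg (restrictStar p h) (vertex_concat_self p w i)
  rw [h4, sub_self] at h3
  exact sub_eq_zero.1 h3

theorem harmonicExt_spec (hp : AffineIndependent ℝ p) (u : Fin (N + 1) → ℝ) :
    IsHarmonic p (harmonicExt p u) ∧ ∀ i, harmonicExt p u (corner p i) = u i := by
  obtain ⟨f, hf, hfu⟩ := exists_harmonicFrom_zero hp u
  have h : ∃ f, IsHarmonic p f ∧ ∀ i, f (corner p i) = u i := ⟨f, hf.isHarmonic, hfu⟩
  rw [harmonicExt, dif_pos h]
  exact h.choose_spec

/-! ### Existence of energy measures. -/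

/-- The discrete energy measure of `a`, integrated against `b`. -/
def carreZero (a b : Fin (N + 1) → ℝ) : ℝ :=
  (1 / 2) * ∑ i, ∑ j, (a i - a j) ^ 2 * (b i + b j)

theorem carreZero_eq (a b : Fin (N + 1) → ℝ) :
    carreZero a b = 2 * formZero a (a * b) - formZero (a ^ 2) b := by
  unfold carreZero formZero
  simp only [Finset.mul_sum, ← Finset.sum_sub_distrib]
  refine Finset.sum_congr rfl fun i _ => Finset.sum_congr rfl fun j _ => ?_
  simp only [Pi.mul_apply, Pi.pow_apply]
  ring

theorem carreZero_const (a : Fin (N + 1) → ℝ) (c : ℝ) :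
    carreZero a (fun _ => c) = 2 * c * formZero a a := by
  unfold carreZero formZero
  simp only [Finset.mul_sum]
  exact Finset.sum_congr rfl fun i _ => Finset.sum_congr rfl fun j _ => by ring

theorem carreZero_mono (a : Fin (N + 1) → ℝ) {b c : Fin (N + 1) → ℝ} (h : ∀ i, b i ≤ c i) :
    carreZero a b ≤ carreZero a c := by
  unfold carreZero
  refine mul_le_mul_of_nonneg_left (Finset.sum_le_sum fun i _ => Finset.sum_le_sum fun j _ => ?_)
    (by norm_num)
  exact mul_le_mul_of_nonneg_left (add_le_add (h i) (h j)) (sq_nonneg _)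

theorem carreZero_add (a b c : Fin (N + 1) → ℝ) :
    carreZero a (b + c) = carreZero a b + carreZero a c := by
  unfold carreZero
  simp only [Finset.mul_sum, ← Finset.sum_add_distrib, Pi.add_apply]
  exact Finset.sum_congr rfl fun i _ => Finset.sum_congr rfl fun j _ => by ring

theorem carreZero_smul (a b : Fin (N + 1) → ℝ) (c : ℝ) :
    carreZero a (c • b) = c * carreZero a b := by
  unfold carreZero
  simp only [Finset.mul_sum, Pi.smul_apply, smul_eq_mul]
  exact Finset.sum_congr rfl fun i _ => Finset.sum_congr rfl fun j _ => by ring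

/-- The level `m` approximation of the energy measure of `f`, integrated against `g`. -/
def carreLevel (p : Fin (N + 1) → EuclideanSpace ℝ (Fin N)) (m : ℕ) (f g : vertsStar p → ℝ) : ℝ :=
  scale N ^ m * wordSum m fun w => carreZero (vals p f w) (vals p g w)

theorem carreLevel_eq (m : ℕ) (f g : C(gasket p, ℝ)) :
    carreLevel p m (restrictStar p f) (restrictStar p g) =
      2 * energyLevel p m (restrictStar p f) (restrictStar p (f * g))
        - energyLevel p m (restrictStar p (f ^ 2)) (restrictStar p g) := by
  rw [carreLevel, energyLevel, energyLevel, mul_left_comm, ← mul_sub]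
  congr 1
  rw [← wordSum_mul_left, wordSum, wordSum, wordSum, ← Finset.sum_sub_distrib]
  exact Finset.sum_congr rfl fun w _ => carreZero_eq _ _

theorem tendsto_carreLevel {f g : C(gasket p, ℝ)} (hf : f ∈ domain p) (hg : g ∈ domain p) :
    Tendsto (fun m => carreLevel p m (restrictStar p f) (restrictStar p g)) atTop
      (𝓝 (2 * energy p f (f * g) - energy p (f ^ 2) g)) := by
  simp only [carreLevel_eq]
  refine ((tendsto_energyLevel hf (domain_mul hf hg)).const_mul 2).sub
    (tendsto_energyLevel ?_ hg)
  rw [pow_two]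
  exact domain_mul hf hf

theorem carreLevel_mono (m : ℕ) (f : vertsStar p → ℝ) {g g' : vertsStar p → ℝ}
    (h : ∀ x, g x ≤ g' x) : carreLevel p m f g ≤ carreLevel p m f g' :=
  mul_le_mul_of_nonneg_left (wordSum_le fun _ _ => carreZero_mono _ fun _ => h _)
    (pow_nonneg scale_pos.le _)

theorem carreLevel_const (m : ℕ) (f : vertsStar p → ℝ) (c : ℝ) :
    carreLevel p m f (fun _ => c) = 2 * c * energyLevel p m f f := by
  rw [carreLevel, energyLevel, mul_left_comm (2 * c)]
  congr 1
  rw [← wordSum_mul_left]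
  exact wordSum_congr fun w _ => carreZero_const _ c

theorem abs_carreLevel_le {f g : C(gasket p, ℝ)} (hf : f ∈ domain p) (m : ℕ) :
    |carreLevel p m (restrictStar p f) (restrictStar p g)| ≤
      2 * ‖g‖ * (energyStar p (restrictStar p f)).toReal := by
  have h0 := mul_le_mul_of_nonneg_left (energyLevel_le hf m) (by positivity : 0 ≤ 2 * ‖g‖)
  have h1 := carreLevel_mono m (restrictStar p f) (g := restrictStar p g) (g' := fun _ => ‖g‖)
    fun x => (abs_le.1 (g.norm_coe_le_norm _)).2
  have h2 := carreLevel_mono m (restrictStar p f) (g := fun _ => -‖g‖) (g' := restrictStar p g)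
    fun x => (abs_le.1 (g.norm_coe_le_norm _)).1
  rw [carreLevel_const] at h1 h2
  rw [abs_le]
  constructor <;> linarith

/-- The discrete energy measures are positive functionals of bounded mass. Their limit along an
ultrafilter is defined on all of C(K), so the Riesz theorem applies without density of the domain;
on the domain the limit is the required expression. -/
theorem exists_isEnergyMeasure {f : C(gasket p, ℝ)} (hf : f ∈ domain p) :
    ∃ ν, IsEnergyMeasure p f ν := by
  set U : Ultrafilter ℕ := hyperfilter ℕ
  have hU : (U : Filter ℕ) ≤ atTop := Nat.hyperfilter_le_atTop
  have hlim : ∀ g : C(gasket p, ℝ), ∃ L, Tendsto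
      (fun m => carreLevel p m (restrictStar p f) (restrictStar p g)) U (𝓝 L) := by
    intro g
    obtain ⟨L, -, hL⟩ := (isCompact_Icc (a := -(2 * ‖g‖ * (energyStar p (restrictStar p f)).toReal))
      (b := 2 * ‖g‖ * (energyStar p (restrictStar p f)).toReal)).ultrafilter_le_nhds
      (U.map fun m => carreLevel p m (restrictStar p f) (restrictStar p g)) (by
        rw [le_principal_iff]
        exact mem_map.2 (univ_mem' fun m => abs_le.1 (abs_carreLevel_le hf m)))
    exact ⟨L, hL⟩
  choose L hL using hlim
  let Λ : CompactlySupportedContinuousMap (gasket p) ℝ →ₗ[ℝ] ℝ :=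
    { toFun := fun g => L g.toContinuousMap
      map_add' := fun g g' => by
        refine tendsto_nhds_unique (hL _) (((hL g.toContinuousMap).add
          (hL g'.toContinuousMap)).congr fun m => ?_)
        rw [carreLevel, carreLevel, carreLevel, ← mul_add]
        congr 1
        rw [← wordSum_add_distrib]
        exact wordSum_congr fun w _ => (carreZero_add _ _ _).symm
      map_smul' := fun c g => by
        refine tendsto_nhds_unique (hL _) (((hL g.toContinuousMap).const_mul c).congr fun m => ?_)
        rw [carreLevel, carreLevel, mul_left_comm]
        congr 1
        rw [← wordSum_mul_left]
        exact wordSum_congr fun w _ => (carreZero_smul _ _ _).symm }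
  have hΛ : ∀ g, 0 ≤ g → 0 ≤ Λ g := by
    intro g hg
    refine ge_of_tendsto' (hL g.toContinuousMap) fun m => ?_
    have h := carreLevel_mono m (restrictStar p f) (g := fun _ => 0)
      (g' := restrictStar p g.toContinuousMap) fun x => hg _
    rwa [carreLevel_const, mul_zero, zero_mul] at h
  refine ⟨RealRMK.rieszMeasure (PositiveLinearMap.mk₀ Λ hΛ), inferInstance, fun g hg => ?_⟩
  have h := RealRMK.integral_rieszMeasure (PositiveLinearMap.mk₀ Λ hΛ)
    (CompactlySupportedContinuousMap.continuousMapEquiv g)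
  refine Eq.trans h ?_
  exact tendsto_nhds_unique (hL g) ((tendsto_carreLevel hf hg).mono_left hU)

theorem isEnergyMeasure_energyMeasure {f : C(gasket p, ℝ)} (hf : f ∈ domain p) :
    IsEnergyMeasure p f (energyMeasure p f) := by
  have h := exists_isEnergyMeasure hf
  rw [energyMeasure, dif_pos h]
  exact h.choose_spec

/-! ### The energy measure of a cell. -/

theorem scale_pow_mul_wordSum_formZero (k : ℕ) (u : Fin (N + 1) → ℝ) :
    scale N ^ k * wordSum k (fun v => formZero (wordVals v u) (wordVals v u)) = formZero u u := by
  induction k with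
  | zero => simp [wordSum_zero, wordVals]
  | succ k ih =>
    conv_rhs => rw [← ih]
    rw [wordSum_succ, pow_succ, mul_assoc, ← wordSum_mul_left]
    congr 1
    refine wordSum_congr fun w _ => ?_
    simp only [wordVals_concat]
    rw [sum_formZero_cellVals _ _ fun i j => cellVals_comm i j _]
    simp only [cellVals_self]

theorem wordSum_ite_eq (w : List (Fin (N + 1))) (F : List (Fin (N + 1)) → ℝ) :
    wordSum w.length (fun v => if v = w then F v else 0) = F w := by
  rw [wordSum, Finset.sum_eq_single w.get]
  · simp
  · intro x _ hx
    exact if_neg fun h => hx (List.ofFn_injective (h.trans (List.ofFn_get w).symm))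
  · simp

open Classical in
theorem wordSum_ite_contrWord_le (hp : AffineIndependent ℝ p) (n : ℕ)
    (x : EuclideanSpace ℝ (Fin N)) (j : Fin (N + 1)) :
    wordSum n (fun v => if contrWord p v (p j) = x then (1 : ℝ) else 0) ≤ 1 := by
  rw [wordSum, Finset.sum_boole, Nat.cast_le_one, Finset.card_le_one]
  intro a ha b hb
  simp only [Finset.mem_filter] at ha hb
  exact List.ofFn_injective (word_eq_of_contrWord_eq hp (by simp) (ha.2.trans hb.2.symm))

/-- In 2 E_m(f, fg) - E_m(f², g) the first term is stationary because f is harmonic, the second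
because g is harmonic from level n on. -/
theorem HarmonicFrom.carreLevel_eq {n m : ℕ} {f g : C(gasket p, ℝ)}
    (hf : HarmonicFrom p 0 (restrictStar p f)) (hg : HarmonicFrom p n (restrictStar p g))
    (hnm : n ≤ m) : carreLevel p m (restrictStar p f) (restrictStar p g) =
      carreLevel p n (restrictStar p f) (restrictStar p g) := by
  rw [SierpinskiGasket.carreLevel_eq, SierpinskiGasket.carreLevel_eq,
    hf.energyLevel_eq (Nat.zero_le m), hf.energyLevel_eq (Nat.zero_le n),
    energyLevel_comm m, energyLevel_comm n, hg.energyLevel_eq hnm]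

theorem IsEnergyMeasure.integral_eq_carreLevel {n : ℕ} {f g : C(gasket p, ℝ)}
    {ν : Measure (gasket p)} (hν : IsEnergyMeasure p f ν)
    (hf : HarmonicFrom p 0 (restrictStar p f)) (hg : HarmonicFrom p n (restrictStar p g)) :
    ∫ x, g x ∂ν = carreLevel p n (restrictStar p f) (restrictStar p g) := by
  rw [hν.integral_eq g hg.mem_domain]
  refine tendsto_nhds_unique (tendsto_carreLevel hf.mem_domain hg.mem_domain) ?_
  refine tendsto_const_nhds.congr' ?_
  filter_upwards [eventually_ge_atTop n] with m hm
  exact (hf.carreLevel_eq hg hm).symm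

theorem IsEnergyMeasure.measureReal_univ {f : C(gasket p, ℝ)}
    {ν : Measure (gasket p)} (hν : IsEnergyMeasure p f ν)
    (hf : HarmonicFrom p 0 (restrictStar p f)) :
    ν.real Set.univ = 2 * energyLevel p 0 (restrictStar p f) (restrictStar p f) := by
  have hg : HarmonicFrom p 0 (restrictStar p (ContinuousMap.const (gasket p) 1)) := by
    intro w _ i
    funext j
    have h := cellVals_mem_Icc (a := 1) (b := 1) (u := fun _ : Fin (N + 1) => 1) (by simp) i j
    rw [Set.Icc_self] at h
    exact h.symm
  have h := hν.integral_eq_carreLevel hf hg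
  have e : carreLevel p 0 (restrictStar p f)
      (restrictStar p (ContinuousMap.const (gasket p) 1)) =
      2 * 1 * energyLevel p 0 (restrictStar p f) (restrictStar p f) := carreLevel_const 0 _ 1
  rw [e] at h
  simpa using h

/-- Test functions dominating the indicator of K_w: splines of level |w| + k of that indicator
restricted to vertices. -/
theorem exists_spline_one_le (hp : AffineIndependent ℝ p) (w : List (Fin (N + 1))) (k : ℕ) :
    ∃ g : C(gasket p, ℝ), HarmonicFrom p (w.length + k) (restrictStar p g) ∧ (∀ x, 0 ≤ g x) ∧
      (∀ x, g x ≤ 1) ∧ (∀ x ∈ cell p w, 1 ≤ g x) ∧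
      ∀ v i, v.length = w.length + k → pt p v i ∉ cell p w → g (pt p v i) = 0 := by
  classical
  set φ : vertsStar p → ℝ := fun x =>
    if Set.inclusion (vertsStar_subset_gasket p) x ∈ cell p w then 1 else 0 with hφ
  have hφ01 : ∀ x, φ x ∈ Set.Icc (0 : ℝ) 1 := by
    intro x
    simp only [hφ]
    split_ifs <;> simp
  obtain ⟨g, hg⟩ := exists_spline hp φ (w.length + k)
  have h01 : ∀ v, g (pt p v 0) ∈ Set.Icc (0 : ℝ) 1 := fun v => by
    rw [hg]; exact wordVals_mem_Icc _ (fun _ => hφ01 _) _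
  refine ⟨g, harmonicFrom_of_splineVals hg, fun x => ?_, fun x => ?_, fun x hx => ?_,
    fun v i hv hvi => ?_⟩
  · exact forall_of_forall_pt (isClosed_le continuous_const g.continuous) (fun v => (h01 v).1) x
  · exact forall_of_forall_pt (isClosed_le g.continuous continuous_const) (fun v => (h01 v).2) x
  · refine forall_mem_cell_of_forall_pt (isClosed_le continuous_const g.continuous)
      (fun v => ?_) hx
    change 1 ≤ g (pt p (w ++ v) 0)
    rw [hg, splineVals, List.take_length_add_append]
    refine (wordVals_mem_Icc (a := 1) (b := 1) _ (fun i => ?_) _).1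
    have hmem : Set.inclusion (vertsStar_subset_gasket p) (vertex p (w ++ v.take k) i) ∈
        cell p w := cell_append_subset p w _ (pt_mem_cell p _ i)
    simp only [hφ]
    rw [if_pos hmem]
    simp
  · rw [hg, splineVals_of_length_le _ _ hv.le]
    exact if_neg hvi

/-- Integrating the test function of level |w| + k, the subcells of K_w contribute at most the
claimed bound. The other contributions come from cells touching K_w at a corner; there are at most
(N+1)² of them, each of energy O(s^(-|w|-k)), and they disappear as k grows. -/
theorem IsEnergyMeasure.measureReal_cell_le (hp : AffineIndependent ℝ p) {f : C(gasket p, ℝ)}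
    {ν : Measure (gasket p)} (hν : IsEnergyMeasure p f ν)
    (hf : HarmonicFrom p 0 (restrictStar p f)) (w : List (Fin (N + 1))) :
    ν.real (cell p w) ≤ 2 * (scale N ^ w.length *
      formZero (vals p (restrictStar p f) w) (vals p (restrictStar p f) w)) := by
  classical
  have := hν.finite
  set a := vals p (restrictStar p f) with ha
  have hvals : ∀ w v, a (w ++ v) = wordVals v (a w) := fun w v => hf.wordVals (Nat.zero_le _) v
  set C : ℝ := 2 * formZero (a []) (a []) with hC
  have hC0 : 0 ≤ C := mul_nonneg zero_le_two (formZero_nonneg _)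
  set r : ℝ := (scale N)⁻¹ with hr
  have hr0 : 0 ≤ r := inv_nonneg.2 scale_pos.le
  have hbound : ∀ k : ℕ, ν.real (cell p w) ≤
      2 * (scale N ^ w.length * formZero (a w) (a w)) +
        ((N : ℝ) + 1) ^ 2 * C * r ^ w.length * r ^ k := by
    intro k
    obtain ⟨g, hg, hg0, hg1, hgw, hgv⟩ := exists_spline_one_le hp w k
    have h1 : ν.real (cell p w) ≤ ∫ x, g x ∂ν := by
      rw [← integral_indicator_one (isClosed_cell p w).measurableSet]
      refine integral_mono ((integrable_const 1).indicator (isClosed_cell p w).measurableSet)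
        (g.continuous.integrable_of_hasCompactSupport (HasCompactSupport.of_compactSpace _)) fun x => ?_
      by_cases hx : x ∈ cell p w
      · simpa [hx] using hgw x hx
      · simpa [hx] using hg0 x
    refine h1.trans ?_
    rw [hν.integral_eq_carreLevel hf hg, carreLevel, wordSum_add, ← wordSum_mul_left]
    -- Counts the coincidences between corners of v and corners of w. It is at least 1 on a cell
    -- outside K_w that touches K_w, and its sum over a level is at most (N+1)².
    set B : List (Fin (N + 1)) → ℝ := fun v =>
      ∑ i, ∑ j, if contrWord p v (p j) = contrWord p w (p i) then (1 : ℝ) else 0 with hB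
    have hB0 : ∀ v, 0 ≤ B v := fun v =>
      Finset.sum_nonneg fun _ _ => Finset.sum_nonneg fun _ _ => by split_ifs <;> simp
    have hle2 : ∀ v, carreZero (a v) (vals p (restrictStar p g) v) ≤ 2 * formZero (a v) (a v) := by
      intro v
      have := carreZero_mono (a v) (b := vals p (restrictStar p g) v) (c := fun _ => 1)
        fun i => hg1 _
      rwa [carreZero_const, mul_one] at this
    have hsmall : ∀ v : List (Fin (N + 1)), v.length = w.length + k →
        scale N ^ (w.length + k) * (2 * formZero (a v) (a v)) ≤ C * r ^ (w.length + k) := by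
      intro v hv
      have h := scale_pow_mul_formZero_wordVals_le v (a [])
      rw [← hvals, List.nil_append, hv] at h
      rw [hC, hr]
      linarith
    have hpt : ∀ v : List (Fin (N + 1)), v.length = w.length → ∀ u : List (Fin (N + 1)),
        u.length = k → scale N ^ (w.length + k) *
          carreZero (a (v ++ u)) (vals p (restrictStar p g) (v ++ u)) ≤
        (if v = w then 2 * scale N ^ (w.length + k) * formZero (a (v ++ u)) (a (v ++ u)) else 0)
          + C * r ^ (w.length + k) * B (v ++ u) := by
      intro v hv u hu
      have hvu : (v ++ u).length = w.length + k := by rw [List.length_append, hv, hu]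
      have hs0 : 0 ≤ scale N ^ (w.length + k) := pow_nonneg scale_pos.le _
      have hCr : 0 ≤ C * r ^ (w.length + k) := by positivity
      have h2 := mul_le_mul_of_nonneg_left (hle2 (v ++ u)) hs0
      split_ifs with hvw
      · have := mul_nonneg hCr (hB0 (v ++ u))
        linarith
      rw [zero_add]
      by_cases hmeet : ∃ j, pt p (v ++ u) j ∈ cell p w
      · obtain ⟨j, y, hy, hyj⟩ := hmeet
        have hyj' : contrWord p w y = contrWord p (v ++ u) (p j) := hyj
        obtain ⟨i, rfl⟩ := eq_vertex_of_contrWord_eq hp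
          (fun h => hvw ((List.prefix_of_prefix_length_le (List.prefix_append v u) h
            hv.le).eq_of_length hv))
          (fun h => hvw (((List.prefix_append v u).trans h).eq_of_length hv))
          (gasket_subset_simplex p hy) (vertex_mem_simplex p j) hyj'
        have hB1 : 1 ≤ B (v ++ u) := by
          have h3 : (if contrWord p (v ++ u) (p j) = contrWord p w (p i) then (1 : ℝ) else 0)
              ≤ ∑ j, if contrWord p (v ++ u) (p j) = contrWord p w (p i) then (1 : ℝ) else 0 :=
            Finset.single_le_sum
              (f := fun j => if contrWord p (v ++ u) (p j) = contrWord p w (p i)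
                then (1 : ℝ) else 0)
              (fun _ _ => by split_ifs <;> simp) (Finset.mem_univ j)
          rw [if_pos hyj'.symm] at h3
          refine h3.trans (Finset.single_le_sum
            (f := fun i => ∑ j, if contrWord p (v ++ u) (p j) = contrWord p w (p i)
              then (1 : ℝ) else 0)
            (fun _ _ => Finset.sum_nonneg fun _ _ => by split_ifs <;> simp) (Finset.mem_univ i))
        exact (h2.trans (hsmall _ hvu)).trans (le_mul_of_one_le_right hCr hB1)
      · push Not at hmeet
        have h0 : vals p (restrictStar p g) (v ++ u) = fun _ => 0 :=
          funext fun j => hgv _ j hvu (hmeet j)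
        rw [h0, carreZero_const, mul_zero, zero_mul, mul_zero]
        exact mul_nonneg hCr (hB0 _)
    calc wordSum w.length (fun v => scale N ^ (w.length + k) * wordSum k fun u =>
          carreZero (a (v ++ u)) (vals p (restrictStar p g) (v ++ u)))
        ≤ wordSum w.length (fun v => (if v = w then 2 * scale N ^ (w.length + k) *
            wordSum k (fun u => formZero (a (v ++ u)) (a (v ++ u))) else 0)
            + C * r ^ (w.length + k) * wordSum k fun u => B (v ++ u)) := by
          refine wordSum_le fun v hv => ?_
          rw [← wordSum_mul_left]
          refine (wordSum_le fun u hu => hpt v hv u hu).trans_eq ?_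
          rw [wordSum_add_distrib, wordSum_mul_left]
          congr 1
          split_ifs
          · rw [wordSum_mul_left]
          · simp [wordSum]
      _ = 2 * (scale N ^ w.length * formZero (a w) (a w)) +
            C * r ^ (w.length + k) * wordSum (w.length + k) B := by
          rw [wordSum_add_distrib, wordSum_ite_eq, wordSum_mul_left, ← wordSum_add]
          simp only [hvals w]
          rw [pow_add, ← scale_pow_mul_wordSum_formZero k (a w)]
          ring
      _ ≤ _ := by
          have hBs : wordSum (w.length + k) B ≤ ((N : ℝ) + 1) ^ 2 := by
            have e : wordSum (w.length + k) B = ∑ i, ∑ j, wordSum (w.length + k) fun v =>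
                if contrWord p v (p j) = contrWord p w (p i) then (1 : ℝ) else 0 := by
              simp only [wordSum, hB]
              rw [Finset.sum_comm]
              exact Finset.sum_congr rfl fun i _ => Finset.sum_comm
            rw [e]
            refine (Finset.sum_le_sum fun i _ => Finset.sum_le_sum fun j _ =>
              wordSum_ite_contrWord_le hp _ _ j).trans_eq ?_
            simp
            ring
          have := mul_le_mul_of_nonneg_left hBs
            (mul_nonneg hC0 (pow_nonneg hr0 (w.length + k)))
          rw [pow_add] at this ⊢
          linarith
  refine ge_of_tendsto' (x := atTop) ?_ hbound
  simpa using ((tendsto_pow_atTop_nhds_zero_of_lt_one hr0 inv_scale_lt_one).const_mul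
    (((N : ℝ) + 1) ^ 2 * C * r ^ w.length)).const_add
      (2 * (scale N ^ w.length * formZero (a w) (a w)))

/-- The upper bounds over all cells of one level add up to the total mass, which is at most the sum
of the cell masses as the cells cover K. So every bound is an equality. -/
theorem IsEnergyMeasure.measureReal_cell (hp : AffineIndependent ℝ p) {f : C(gasket p, ℝ)}
    {ν : Measure (gasket p)} (hν : IsEnergyMeasure p f ν)
    (hf : HarmonicFrom p 0 (restrictStar p f)) (w : List (Fin (N + 1))) :
    ν.real (cell p w) = 2 * (scale N ^ w.length *
      formZero (vals p (restrictStar p f) w) (vals p (restrictStar p f) w)) := by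
  have := hν.finite
  set a := vals p (restrictStar p f) with ha
  have hle : ∀ x ∈ (Finset.univ : Finset (Fin w.length → Fin (N + 1))),
      ν.real (cell p (List.ofFn x)) ≤
        2 * (scale N ^ w.length * formZero (a (List.ofFn x)) (a (List.ofFn x))) := by
    intro x _
    have h := hν.measureReal_cell_le hp hf (List.ofFn x)
    rwa [List.length_ofFn] at h
  have hsum : ∑ x : Fin w.length → Fin (N + 1),
      2 * (scale N ^ w.length * formZero (a (List.ofFn x)) (a (List.ofFn x))) =
        ν.real Set.univ := by
    rw [hν.measureReal_univ hf, ← hf.energyLevel_eq (Nat.zero_le w.length), energyLevel,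
      ← Finset.mul_sum, ← Finset.mul_sum]
    rfl
  have hcover : ν.real Set.univ ≤ ∑ x : Fin w.length → Fin (N + 1),
      ν.real (cell p (List.ofFn x)) := by
    refine (measureReal_mono ?_).trans (measureReal_iUnion_fintype_le _)
    intro x _
    obtain ⟨v, hv, hxv⟩ := exists_mem_cell w.length x
    rw [← hv]
    exact Set.mem_iUnion.2 ⟨v.get, by rwa [List.ofFn_get]⟩
  have heq := (Finset.sum_eq_sum_iff_of_le hle).1
    (le_antisymm (Finset.sum_le_sum hle) (hsum.le.trans hcover)) w.get (Finset.mem_univ _)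
  rwa [List.ofFn_get] at heq

theorem energyMeasure_real_cell (hp : AffineIndependent ℝ p) {h : C(gasket p, ℝ)}
    (hh : IsHarmonic p h) (w : List (Fin (N + 1))) :
    (energyMeasure p h).real (cell p w) = 2 * scale N ^ w.length *
      formZero (wordVals w fun i => h (corner p i)) (wordVals w fun i => h (corner p i)) := by
  have hf := hh.harmonicFrom hp
  have hv : vals p (restrictStar p h) w = wordVals w fun i => h (corner p i) :=
    hf.wordVals (w := []) (Nat.zero_le _) w
  rw [(isEnergyMeasure_energyMeasure hh.1).measureReal_cell hp hf w, hv, mul_assoc]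

theorem kusuoka_real_cell (hp : AffineIndependent ℝ p) (w : List (Fin (N + 1))) :
    (kusuoka p).real (cell p w) = 2 * scale N ^ w.length *
      ∑ k, formZero (wordVals w (Pi.single k 1)) (wordVals w (Pi.single k 1)) := by
  have hfin : ∀ k, energyMeasure p (harmonicExt p (Pi.single k 1)) (cell p w) ≠ ∞ := fun k => by
    have := (isEnergyMeasure_energyMeasure
      (harmonicExt_spec hp (Pi.single k 1 : Fin (N + 1) → ℝ)).1.1).finite
    exact measure_ne_top _ _
  rw [Measure.real, kusuoka, Measure.finsetSum_apply, ENNReal.toReal_sum fun k _ => hfin k,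
    Finset.mul_sum]
  refine Finset.sum_congr rfl fun k _ => ?_
  have h := harmonicExt_spec hp (Pi.single k 1 : Fin (N + 1) → ℝ)
  have h2 := energyMeasure_real_cell hp h.1 w
  simp only [h.2] at h2
  exact h2

/-! ### Limits of the ratio and the density on V_*. -/

theorem cellRatio_eq (hp : AffineIndependent ℝ p) {h : C(gasket p, ℝ)}
    (hh : IsHarmonic p h) (w : List (Fin (N + 1))) :
    cellRatio p h w =
      formZero (wordVals w fun i => h (corner p i)) (wordVals w fun i => h (corner p i)) /
        ∑ k, formZero (wordVals w (Pi.single k 1)) (wordVals w (Pi.single k 1)) := by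
  have hs : 2 * scale N ^ w.length ≠ 0 := mul_ne_zero two_ne_zero (pow_ne_zero _ scale_pos.ne')
  rw [cellRatio, energyMeasure_real_cell hp hh, kusuoka_real_cell hp, mul_div_mul_left _ _ hs]

/-- The limit of the density at the vertex `ψ_w(p_j)` along the cells `w j ⋯ j`. -/
def densityLimit (u : Fin (N + 1) → ℝ) (w : List (Fin (N + 1))) (j : Fin (N + 1)) : ℝ :=
  flux j (wordVals w u) ^ 2 / ∑ k, flux j (wordVals w (Pi.single k 1)) ^ 2

/-- Under `self` all fluxes scale by the common factor `(scale N)⁻¹`; under `comm` they only change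
sign. -/
theorem compatible_densityLimit (u : Fin (N + 1) → ℝ) : Compatible (densityLimit u) where
  self w i := by
    have hs : (scale N)⁻¹ ^ 2 ≠ 0 := pow_ne_zero _ (inv_ne_zero scale_pos.ne')
    simp only [densityLimit, wordVals_concat, flux_cellVals_self, mul_pow, ← Finset.mul_sum]
    exact mul_div_mul_left _ _ hs
  comm w i j := by
    by_cases hij : j = i
    · rw [hij]
    · simp only [densityLimit, wordVals_concat, flux_cellVals_antisymm hij, neg_sq]

/-- Numerator and denominator are both rescaled by `(scale N ^ 2) ^ n`, which cancels, as does the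
factor 1/N of the two limits. -/
theorem tendsto_cellRatio (hN : N ≠ 0) (hp : AffineIndependent ℝ p) {h : C(gasket p, ℝ)}
    (hh : IsHarmonic p h) (w : List (Fin (N + 1))) (j : Fin (N + 1)) :
    Tendsto (fun n : ℕ => cellRatio p h (w ++ List.replicate n j)) atTop
      (𝓝 (densityLimit (fun i => h (corner p i)) w j)) := by
  have hN' : (N : ℝ) ≠ 0 := Nat.cast_ne_zero.2 hN
  have hnum := tendsto_formZero_wordVals_replicate hN j (wordVals w fun i => h (corner p i))
  have hden := tendsto_finsetSum Finset.univ fun k _ =>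
    tendsto_formZero_wordVals_replicate hN j (wordVals w (Pi.single k 1))
  rw [← Finset.sum_div] at hden
  have hpos := sum_sq_flux_wordVals_pos hN w j
  have hlim := hnum.div hden (div_ne_zero hpos.ne' hN')
  rw [div_div_div_cancel_right₀ hN'] at hlim
  refine hlim.congr fun n => ?_
  have hs : (scale N ^ 2) ^ n ≠ 0 := pow_ne_zero _ (pow_ne_zero _ scale_pos.ne')
  rw [cellRatio_eq hp hh, Pi.div_apply, ← Finset.mul_sum, mul_div_mul_left _ _ hs]
  simp only [wordVals_append]

end SierpinskiGasket

end

theorem lemma2p2 (N : ℕ) (hN : 2 ≤ N) (p : Fin (N + 1) → EuclideanSpace ℝ (Fin N))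
    (hp : AffineIndependent ℝ p) (h : C(SierpinskiGasket.gasket p, ℝ))
    (hh : SierpinskiGasket.IsHarmonic p h) :
    (∀ w : List (Fin (N + 1)),
      0 < (SierpinskiGasket.kusuoka p).real (SierpinskiGasket.cell p w)) ∧
    (∀ (w : List (Fin (N + 1))) (i j : Fin (N + 1)), ∃ L : ℝ,
      Tendsto (fun n : ℕ => SierpinskiGasket.cellRatio p h (w ++ i :: List.replicate n j))
        atTop (𝓝 L) ∧
      Tendsto (fun n : ℕ => SierpinskiGasket.cellRatio p h (w ++ j :: List.replicate n i))
        atTop (𝓝 L)) ∧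
    ∃! δ : SierpinskiGasket.vertsStar p → ℝ,
      ∀ (w : List (Fin (N + 1))) (i j : Fin (N + 1)),
        Tendsto (fun n : ℕ => SierpinskiGasket.cellRatio p h (w ++ i :: List.replicate n j))
          atTop (𝓝 (δ (SierpinskiGasket.vertex p (w ++ [i]) j))) := by
  open SierpinskiGasket in
  have hN0 : N ≠ 0 := by omega
  have hG := compatible_densityLimit fun i => h (corner p i)
  have hlim : ∀ (w : List (Fin (N + 1))) (i j : Fin (N + 1)),
      Tendsto (fun n : ℕ => cellRatio p h (w ++ i :: List.replicate n j)) atTop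
        (𝓝 (densityLimit (fun i => h (corner p i)) (w ++ [i]) j)) := by
    intro w i j
    simpa using tendsto_cellRatio hN0 hp hh (w ++ [i]) j
  refine ⟨fun w => ?_, fun w i j => ⟨_, hlim w i j, ?_⟩, ?_⟩
  -- Since `Measure.real` sends infinite mass to 0, positivity here includes finiteness.
  · rw [kusuoka_real_cell hp]
    exact mul_pos (mul_pos two_pos (pow_pos scale_pos _)) (sum_formZero_wordVals_pos hN0 w)
  · rw [hG.comm]
    exact hlim w j i
  · choose W I hWI using fun x : vertsStar p => exists_vertex x
    refine ⟨fun x => densityLimit (fun i => h (corner p i)) (W x) (I x), fun w i j => ?_,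
      fun δ hδ => funext fun x => ?_⟩
    · have e : densityLimit (fun i => h (corner p i)) (W (vertex p (w ++ [i]) j))
          (I (vertex p (w ++ [i]) j)) =
          densityLimit (fun i => h (corner p i)) (w ++ [i]) j :=
        hG.eq hp (congrArg Subtype.val (hWI (vertex p (w ++ [i]) j))).symm
      simp only [e]
      exact hlim w i j
    -- The case i = j already reaches every point of V_*, as ψ_{wi}(p_i) = ψ_w(p_i).
    · have h1 := tendsto_nhds_unique (hδ (W x) (I x) (I x)) (hlim (W x) (I x) (I x))
      rwa [vertex_concat_self, ← hWI, hG.self] at h1
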